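/- **Theorem (Explicit Noether normalization for affine algebras).** Let $\mathbb{F}$ be a field with algebraic closure $\overline{\mathbb{F}}$, let $n,d\ge 1$ and $1\le m,k\le n$ be integers, and let $d_1,\dots,d_n$ be pairwise coprime integers greater than $d$. Let $M=(c_{i,j})\in\mathbb{F}^{m\times n}$ be a $k$-regular matrix, i.e., any $k$ distinct columns of $M$ are linearly independent, and put \[ f_i=\sum_{j=1}^n c_{i,j}X_j^{d_j}\in\mathbb{F}[X_1,\dots,X_n]\qquad(1\le i\le m). \] Let $A$ be a commutative $\mathbb{F}$-algebra generated by $a_1,\dots,a_n\in A$, of Krull dimension at most $k$. Let $I\subseteq\mathbb{F}[X_1,\dots,X_n]$ be the ideal of all polynomial relations satisfied by $a=(a_1,\dots,a_n)$, and suppose that the affine variety $V(I)\subseteq\overline{\mathbb{F}}^n$ has degree at most $d$. Here the degree of an irreducible affine variety $V\subseteq\overline{\mathbb{F}}^n$ over $\overline{\mathbb{F}}$ is the number of points in which it meets an affine subspace of codimension $\dim V$ in general position, and the degree of an affine variety is the sum of the degrees of its irreducible components over $\overline{\mathbb{F}}$. Then: 1. $A$ is a finitely generated module over its subring $S=\mathbb{F}[f_1(a),\dots,f_m(a)]$.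 2. If, moreover, the Krull dimension of $A$ equals $k$ and $k=m$, then $f_1(a),\dots,f_m(a)$ are algebraically independent over $\mathbb{F}$, and hence $S$ is isomorphic, as an $\mathbb{F}$-algebra, to the polynomial ring $\mathbb{F}[Y_1,\dots,Y_m]$ via $f_i(a)\mapsto Y_i$. -/

import Mathlib

noncomputable section

namespace NoetherNorm

open MvPolynomial

section Variety

variable {K : Type*} [Field K] {n : ℕ}

/-- `V ⊆ Kⁿ` is the set of common zeros of an ideal of `K[X₁, …, Xₙ]`. For an algebraically closed
field `K`, these are the affine varieties in affine `n`-space over `K`. -/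
def IsAffineVariety (V : Set (Fin n → K)) : Prop :=
  ∃ I : Ideal (MvPolynomial (Fin n) K), V = zeroLocus K I

/-- An affine variety is irreducible if it is nonempty and is not the union of two proper affine
subvarieties. -/
def IsIrreducibleVariety (V : Set (Fin n → K)) : Prop :=
  IsAffineVariety V ∧ V.Nonempty ∧
    ∀ V₁ V₂ : Set (Fin n → K), IsAffineVariety V₁ → IsAffineVariety V₂ →
      V = V₁ ∪ V₂ → V₁ = V ∨ V₂ = V

/-- The irreducible components: the maximal irreducible subvarieties. -/
def components (V : Set (Fin n → K)) : Set (Set (Fin n → K)) :=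
  {W | Maximal (fun Z => IsIrreducibleVariety Z ∧ Z ⊆ V) W}

/-- The dimension of `V`: the supremum of the lengths `r` of chains `V₀ ⊊ V₁ ⊊ ⋯ ⊊ Vᵣ` of
irreducible subvarieties of `V`. -/
def dimension (V : Set (Fin n → K)) : WithBot ℕ∞ :=
  Order.krullDim {W : Set (Fin n → K) // IsIrreducibleVariety W ∧ W ⊆ V}

/-- The solution set of the linear system `C x = b`. For `C` of rank `r` this is an affine subspace
of codimension `r`, and every affine subspace of codimension `r` arises in this way. -/
def linearSection {r : ℕ} (C : Matrix (Fin r) (Fin n) K) (b : Fin r → K) : Set (Fin n → K) :=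
  {x | C.mulVec x = b}

/-- `δ` is the number of points of `V ∩ L` for affine subspaces `L` of codimension `r` in general
position: there is a nonzero polynomial `G` in the coefficients of a system of `r` affine linear
equations such that `V ∩ L` has `δ` points for the solution set `L` of every system at which `G`
does not vanish. (Over an infinite field there is at most one such `δ`; the rank condition on the
system is itself the nonvanishing of a polynomial if `r ≤ n`.) -/
def IsGenericSectionCard (V : Set (Fin n → K)) (r : ℕ) (δ : ℕ∞) : Prop :=
  ∃ G : MvPolynomial ((Fin r × Fin n) ⊕ Fin r) K, G ≠ 0 ∧
    ∀ (C : Matrix (Fin r) (Fin n) K) (b : Fin r → K),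
      eval (Sum.elim (fun p : Fin r × Fin n => C p.1 p.2) b) G ≠ 0 →
        (V ∩ linearSection C b).encard = δ

/-- The degree of an irreducible affine variety over an algebraically closed field: the number of
its intersections with an affine subspace of codimension `dim V` in general position. The infimum
is over a set with exactly one element. -/
def irreducibleDegree (V : Set (Fin n → K)) : ℕ∞ :=
  sInf {δ : ℕ∞ | ∃ r : ℕ, dimension V = r ∧ IsGenericSectionCard V r δ}

/-- The degree of an affine variety over an algebraically closed field: the sum of the degrees of
its (finitely many) irreducible components. -/
def degree (V : Set (Fin n → K)) : ℕ∞ :=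
  ∑ᶠ W ∈ components V, irreducibleDegree W

end Variety

section Construction

variable {F : Type*} [Field F] {m n : ℕ}

/-- Any `k` distinct columns of `M` are linearly independent. -/
def IsRegularMatrix (k : ℕ) (M : Matrix (Fin m) (Fin n) F) : Prop :=
  ∀ s : Finset (Fin n), s.card = k → LinearIndependent F (fun j : s => fun i : Fin m => M i j)

/-- The polynomials `fᵢ = ∑ⱼ cᵢⱼ Xⱼ ^ eⱼ`. -/
def dklPoly (M : Matrix (Fin m) (Fin n) F) (e : Fin n → ℕ) (i : Fin m) : MvPolynomial (Fin n) F :=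
  ∑ j, C (M i j) * X j ^ e j

/-- The degree of the affine variety `V(I)` over an arbitrary field `F`, where `V(I)` consists of
the common zeros of `I` with coordinates in the algebraic closure of `F`: by definition, the degree
of the same set as an affine variety over the algebraic closure. -/
def degreeOfIdeal (I : Ideal (MvPolynomial (Fin n) F)) : ℕ∞ :=
  degree (zeroLocus (AlgebraicClosure F) I)

end Construction

end NoetherNorm

end

noncomputable section

namespace NoetherNorm

open MvPolynomial

/-! ### Krull dimension and integral ring homomorphisms. -/

section Dimension

/-! It suffices that every `a j` is integral over the `f_i(a)`. Integrality can be tested modulo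
each prime of `A`. Such a prime lifts to a prime `Q'` of `K[X]`, with `K` the algebraic closure of
`F`, and `Q'` contains a prime `Q` for which `V(Q)` is a component of `V(I)`, of some dimension `r ≤
k` and degree at most `d`.

Valuations (`isIntegralElem_of_relations`): if a coordinate `x_j` in the fraction field of `K[X]/Q'`
were not integral, some valuation would be at most 1 on all `f_i(x)` but exceed 1 at `x_j`. By
`k`-regularity the largest value `w` among the `x_j ^ e_j` is attained at least `k + 1` times, since
otherwise a combination of the `f_i` isolates one dominant term. As the `e_j > d` are pairwise
coprime, distinct monomials of degree at most `d` in these `k + 1` coordinates have distinct values,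
so no nonzero polynomial of degree at most `d` vanishes at them.

Geometry (`exists_relation_of_isGenericSectionCard`): such a polynomial does exist, because the
image of `V(Q)` in affine `(r + 1)`-space satisfies an equation of degree at most `deg V(Q)`.
Otherwise `r + 1` general linear forms also have no relation of degree at most `d`. Their minimal
relation, of degree `D > d`, becomes monic and separable in one form after a general shear, so `D`
distinct points of `V(Q)` lie on a general linear section of complementary dimension, which has at
most `d` points.

Independence in the second claim is a dimension count: a relation between the `f_i(a)` would make
the dimension of `A` smaller than `m`. -/

/-- An integral ring homomorphism does not raise the Krull dimension. -/
theorem ringKrullDim_le_of_isIntegral {R S : Type*} [CommRing R] [CommRing S] (f : R →+* S)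
    (hf : f.IsIntegral) : ringKrullDim S ≤ ringKrullDim R := by
  let := f.toAlgebra
  have : Algebra.IsIntegral R S := ⟨hf⟩
  refine Order.krullDim_le_of_strictMono (PrimeSpectrum.comap f) fun p q hpq => ?_
  have : p.asIdeal < q.asIdeal := hpq
  exact Ideal.IsIntegral.comap_lt_comap (R := R) this

/-- If a ring of dimension `r` is integral over the subalgebra generated by `r` elements, then
these elements are algebraically independent. -/
theorem algebraicIndependent_of_isIntegral {K B : Type*} [Field K] [CommRing B] [Algebra K B]
    {r : ℕ} (f : Fin r → B)
    (hf : (aeval f : MvPolynomial (Fin r) K →ₐ[K] B).toRingHom.IsIntegral)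
    (hdim : (r : WithBot ℕ∞) ≤ ringKrullDim B) : AlgebraicIndependent K f := by
  rw [algebraicIndependent_iff]
  intro p hp
  by_contra hp0
  let φ : MvPolynomial (Fin r) K →+* B := (aeval f : MvPolynomial (Fin r) K →ₐ[K] B).toRingHom
  have h1 : ringKrullDim φ.range + 1 ≤ ringKrullDim (MvPolynomial (Fin r) K) :=
    ringKrullDim_succ_le_of_surjective φ.rangeRestrict φ.rangeRestrict_surjective
      (mem_nonZeroDivisors_of_ne_zero hp0) (Subtype.ext hp)
  have h2 : ringKrullDim B ≤ ringKrullDim φ.range :=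
    ringKrullDim_le_of_isIntegral φ.range.subtype
      (RingHom.IsIntegral.tower_top φ.rangeRestrict _ hf)
  rw [MvPolynomial.ringKrullDim_of_isNoetherianRing, ringKrullDim_eq_zero_of_field, zero_add,
    Nat.card_eq_fintype_card, Fintype.card_fin] at h1
  have h3 : ((r : WithBot ℕ∞) + 1) ≤ r := le_trans (by gcongr; exact hdim.trans h2) h1
  have h4 : ((r + 1 : ℕ) : WithBot ℕ∞) ≤ (r : ℕ) := by exact_mod_cast h3
  have h5 : r + 1 ≤ r := by exact_mod_cast h4
  omega

end Dimension

/-! ### Integrality by valuations, regular matrices and coprime exponents. -/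

section Integrality

/-- Integrality over a ring may be checked modulo every prime ideal. -/
theorem isIntegralElem_of_forall_isPrime {R A : Type*} [CommRing R] [CommRing A] (φ : R →+* A)
    (x : A) (h : ∀ p : Ideal A, p.IsPrime → ∃ g : Polynomial R, g.Monic ∧ g.eval₂ φ x ∈ p) :
    φ.IsIntegralElem x := by
  -- `T` is the multiplicative set of values at `x` of monic polynomials. Integrality of `x` means
  -- `0 ∈ T`; otherwise some prime avoids `T`.
  let T : Submonoid A := (Submonoid.mk (Subsemigroup.mk {g : Polynomial R | g.Monic}
    (fun ha hb => Polynomial.Monic.mul ha hb)) Polynomial.monic_one).map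
      (Polynomial.eval₂RingHom φ x)
  by_contra hx
  have h0 : Disjoint ((⊥ : Ideal A) : Set A) T := by
    rw [Set.disjoint_left]
    rintro y hy ⟨g, hg, hgy⟩
    exact hx ⟨g, hg, hgy.trans hy⟩
  obtain ⟨p, hp, -, hpT⟩ := Ideal.exists_le_prime_disjoint ⊥ T h0
  obtain ⟨g, hg, hgp⟩ := h p hp
  exact Set.disjoint_left.1 hpT hgp ⟨g, hg, rfl⟩

variable {E Γ : Type*} [Field E] [LinearOrderedCommGroupWithZero Γ] (v : Valuation E Γ)

/-- Elements whose values are roots of order `eᵢ` of one value `w > 1`, with pairwise coprime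
`eᵢ`, satisfy no polynomial relation of degree less than all `eᵢ`. -/
theorem aeval_ne_zero_of_valuation_pow_eq {K : Type*} [Field K] [Algebra K E]
    (hv : ∀ c : K, c ≠ 0 → v (algebraMap K E c) = 1) {s : ℕ} (x : Fin s → E) (e : Fin s → ℕ)
    (hcop : Pairwise fun i j => Nat.Coprime (e i) (e j)) {w : Γ} (hw : 1 < w)
    (hx : ∀ i, v (x i) ^ e i = w) (P : MvPolynomial (Fin s) K) (hP : P ≠ 0)
    (hdeg : ∀ i, P.totalDegree < e i) : aeval x P ≠ 0 := by
  classical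
  have hw0 : w ≠ 0 := (zero_lt_one.trans hw).ne'
  have hinj : ∀ α ∈ P.support, ∀ β ∈ P.support,
      ∏ i, v (x i) ^ α i = ∏ i, v (x i) ^ β i → α = β := by
    intro α hα β hβ hαβ
    -- Raising to the power `∏ e i` turns every monomial value into a power of `w`, so values are
    -- compared by natural-number exponents.
    have key : ∀ γ : Fin s →₀ ℕ, (∏ i, v (x i) ^ γ i) ^ (∏ i, e i) =
        w ^ (∑ i, γ i * ∏ j ∈ Finset.univ.erase i, e j) := by
      intro γ
      rw [← Finset.prod_pow, ← Finset.prod_pow_eq_pow_sum]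
      refine Finset.prod_congr rfl fun i _ => ?_
      rw [← hx i, ← pow_mul, ← pow_mul, ← Finset.mul_prod_erase Finset.univ e (Finset.mem_univ i)]
      ring_nf
    have hsum : ∑ i, α i * ∏ j ∈ Finset.univ.erase i, e j =
        ∑ i, β i * ∏ j ∈ Finset.univ.erase i, e j := by
      apply pow_right_injective₀ (zero_lt_one.trans hw) hw.ne'
      simp only [← key, hαβ]
    ext i
    -- Modulo `e i` only the `i`-th summand survives, and its cofactor is invertible. Hence `α i` is
    -- determined modulo `e i`, and so determined, being less than `e i`.
    have hmod : ∀ γ : Fin s →₀ ℕ, ∑ i, γ i * ∏ j ∈ Finset.univ.erase i, e j ≡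
        γ i * ∏ j ∈ Finset.univ.erase i, e j [MOD e i] := by
      intro γ
      rw [← Finset.add_sum_erase _ _ (Finset.mem_univ i)]
      refine Nat.ModEq.trans (Nat.ModEq.add_left _ ((Nat.modEq_zero_iff_dvd).2 ?_)) (by rfl)
      refine Finset.dvd_sum fun l hl => Dvd.dvd.mul_left (Finset.dvd_prod_of_mem _ ?_) _
      exact Finset.mem_erase.2 ⟨(Finset.ne_of_mem_erase hl).symm, Finset.mem_univ _⟩
    have h1 : α i * ∏ j ∈ Finset.univ.erase i, e j ≡ β i * ∏ j ∈ Finset.univ.erase i, e j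
        [MOD e i] := (hmod α).symm.trans (by rw [hsum]; exact hmod β)
    have hc : Nat.gcd (e i) (∏ j ∈ Finset.univ.erase i, e j) = 1 :=
      Nat.Coprime.prod_right fun j hj => hcop (Finset.ne_of_mem_erase hj).symm
    have h2 := Nat.ModEq.cancel_right_of_coprime hc h1
    have hlt : ∀ γ ∈ P.support, γ i < e i := fun γ hγ =>
      lt_of_le_of_lt ((Finsupp.le_degree i γ).trans (le_totalDegree hγ)) (hdeg i)
    exact Nat.ModEq.eq_of_lt_of_lt h2 (hlt α hα) (hlt β hβ)
  have hxi : ∀ i, v (x i) ≠ 0 := by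
    intro i h0
    have := hx i
    rw [h0, zero_pow (by have := hdeg i; omega)] at this
    exact hw0 this.symm
  obtain ⟨α, hα, hmax⟩ := P.support.exists_max_image (fun α => ∏ i, v (x i) ^ α i)
    (by simpa [Finset.nonempty_iff_ne_empty] using hP)
  have hval : ∀ β ∈ P.support, v (algebraMap K E (P.coeff β) * ∏ i, x i ^ β i) =
      ∏ i, v (x i) ^ β i := by
    intro β hβ
    rw [map_mul, hv _ (mem_support_iff.1 hβ), one_mul, map_prod]
    simp
  have hsum : v (aeval x P) = v (algebraMap K E (P.coeff α) * ∏ i, x i ^ α i) := by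
    rw [aeval_def, eval₂_eq']
    refine v.map_sum_eq_of_lt hα fun β hβ => ?_
    rw [Finset.mem_sdiff, Finset.mem_singleton] at hβ
    rw [hval α hα, hval β hβ.1]
    exact lt_of_le_of_ne (hmax β hβ.1) fun h => hβ.2 (hinj _ hβ.1 _ hα h)
  intro h0
  rw [h0, map_zero, hval α hα] at hsum
  exact (Finset.prod_ne_zero_iff.2 fun i _ => pow_ne_zero _ (hxi i)) hsum.symm

/-- If the columns of a matrix indexed by `s` are linearly independent, then some combination of
the rows is a unit vector on `s`. -/
theorem exists_row_combination {F : Type*} [Field F] {m n : ℕ} (M : Matrix (Fin m) (Fin n) F)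
    (s : Finset (Fin n)) (hs : LinearIndependent F (fun j : s => fun i : Fin m => M i j))
    (j₀ : Fin n) : ∃ c : Fin m → F, ∀ j ∈ s, ∑ i, c i * M i j = if j = j₀ then 1 else 0 := by
  classical
  by_cases hj₀ : j₀ ∈ s
  swap
  · refine ⟨0, fun j hj => ?_⟩
    rw [if_neg (by rintro rfl; exact hj₀ hj)]
    simp
  -- The `j₀`-th coordinate of a left inverse of the column map is a functional on `Fin m → F`; its
  -- coefficients are those of the row combination.
  obtain ⟨φ, hφ⟩ := (Fintype.linearCombination F
    (fun j : s => fun i : Fin m => M i j)).exists_leftInverse_of_injective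
      (LinearMap.ker_eq_bot.2 hs.fintypeLinearCombination_injective)
  refine ⟨fun i => φ (Pi.single i 1) ⟨j₀, hj₀⟩, fun j hj => ?_⟩
  have h1 := LinearMap.congr_fun hφ (Pi.single ⟨j, hj⟩ 1)
  have h2 : (fun i => M i j) = ∑ i, M i j • (Pi.single i (1 : F) : Fin m → F) := by
    ext i; simp [Finset.sum_apply, Pi.single_apply]
  simp only [LinearMap.comp_apply, Fintype.linearCombination_apply_single, one_smul,
    LinearMap.id_apply] at h1
  rw [h2, map_sum] at h1
  have h3 := congrFun h1 ⟨j₀, hj₀⟩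
  simp only [map_smul, Finset.sum_apply, Pi.smul_apply, smul_eq_mul, Pi.single_apply,
    Subtype.mk.injEq] at h3
  simpa [mul_comm, eq_comm] using h3

/-- If the combinations `∑ⱼ Mᵢⱼ xⱼ` with a `k`-regular matrix have values at most `1`, then so have
all `xⱼ`, or else the largest value of an `xⱼ` is attained more than `k` times. -/
theorem exists_card_eq_of_regular {F : Type*} [Field F] [Algebra F E]
    (hv : ∀ c : F, v (algebraMap F E c) ≤ 1) {m n k : ℕ} (hkn : k ≤ n)
    (M : Matrix (Fin m) (Fin n) F) (hM : IsRegularMatrix k M) (x : Fin n → E)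
    (hx : ∀ i, v (∑ j, algebraMap F E (M i j) * x j) ≤ 1) (j₁ : Fin n) (hj₁ : 1 < v (x j₁)) :
    ∃ w : Γ, 1 < w ∧ ∃ s : Finset (Fin n), s.card = k + 1 ∧ ∀ j ∈ s, v (x j) = w := by
  classical
  obtain ⟨j₀, -, hmax⟩ := Finset.univ.exists_max_image (fun j => v (x j)) ⟨j₁, Finset.mem_univ _⟩
  have hw : 1 < v (x j₀) := hj₁.trans_le (hmax j₁ (Finset.mem_univ _))
  refine ⟨v (x j₀), hw, ?_⟩
  let J : Finset (Fin n) := {j | v (x j) = v (x j₀)}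
  by_cases hJ : k + 1 ≤ J.card
  · obtain ⟨s, hs, hcard⟩ := Finset.exists_subset_card_eq hJ
    exact ⟨s, hcard, fun j hj => (Finset.mem_filter.1 (hs hj)).2⟩
  exfalso
  -- With at most `k` maximal terms, `J` extends to exactly `k` columns. The row combination that is
  -- the unit vector of `j₀` on `s` kills the other maximal terms, so `x j₀` strictly dominates what
  -- remains.
  obtain ⟨s, hJs, -, hcard⟩ := Finset.exists_subsuperset_card_eq (Finset.subset_univ J)
    (by omega : J.card ≤ k) (by simpa using hkn)
  obtain ⟨c, hc⟩ := exists_row_combination M s (hM s hcard) j₀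
  have hj₀s : j₀ ∈ s := hJs (by simp [J])
  have h1 : ∑ i, algebraMap F E (c i) * ∑ j, algebraMap F E (M i j) * x j =
      ∑ j, algebraMap F E (∑ i, c i * M i j) * x j := by
    simp_rw [Finset.mul_sum, map_sum, Finset.sum_mul]
    rw [Finset.sum_comm]
    simp [mul_assoc]
  have h2 : v (∑ i, algebraMap F E (c i) * ∑ j, algebraMap F E (M i j) * x j) ≤ 1 := by
    refine v.map_sum_le fun i _ => ?_
    rw [map_mul]
    exact mul_le_one' (hv _) (hx i)
  have h3 : v (∑ j, algebraMap F E (∑ i, c i * M i j) * x j) =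
      v (algebraMap F E (∑ i, c i * M i j₀) * x j₀) := by
    have hone : v (algebraMap F E (∑ i, c i * M i j₀) * x j₀) = v (x j₀) := by
      rw [hc j₀ hj₀s]; simp
    refine v.map_sum_eq_of_lt (Finset.mem_univ j₀) fun j hj => ?_
    rw [hone]
    by_cases hjs : j ∈ s
    · rw [hc j hjs, if_neg (by simpa using hj)]
      simpa using zero_lt_one.trans hw
    · rw [map_mul]
      refine lt_of_le_of_lt (mul_le_of_le_one_left' (hv _)) ?_
      refine lt_of_le_of_ne (hmax j (Finset.mem_univ _)) fun h => hjs (hJs ?_)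
      simp [J, h]
  rw [h1, h3, hc j₀ hj₀s] at h2
  simp at h2
  exact absurd hw (not_lt.2 h2)

/-- Let `K` be algebraic over `F` and let any `k + 1` of the `xⱼ` satisfy a polynomial relation of
degree at most `d` over `K`. Then all `xⱼ` are integral over the `∑ⱼ Mᵢⱼ xⱼ ^ eⱼ`, if `M` is
`k`-regular and the `eⱼ > d` are pairwise coprime. -/
theorem isIntegralElem_of_relations {F K : Type*} [Field F] [Field K] [Algebra F K] [Algebra K E]
    [Algebra F E] [IsScalarTower F K E] [Algebra.IsAlgebraic F K] {m n k d : ℕ} (hkn : k ≤ n)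
    (e : Fin n → ℕ) (he : ∀ j, d < e j) (hcop : Pairwise fun i j => Nat.Coprime (e i) (e j))
    (M : Matrix (Fin m) (Fin n) F) (hM : IsRegularMatrix k M) (x : Fin n → E)
    (hrel : ∀ ι : Fin (k + 1) → Fin n, Function.Injective ι →
      ∃ P : MvPolynomial (Fin (k + 1)) K, P ≠ 0 ∧ P.totalDegree ≤ d ∧ aeval (x ∘ ι) P = 0)
    (j : Fin n) :
    (aeval (fun i => aeval x (dklPoly M e i)) :
      MvPolynomial (Fin m) F →ₐ[F] E).toRingHom.IsIntegralElem (x j) := by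
  let φ : MvPolynomial (Fin m) F →ₐ[F] E := aeval (fun i => aeval x (dklPoly M e i))
  let := φ.toRingHom.toAlgebra
  by_contra hj
  let R : Subring E := (integralClosure (MvPolynomial (Fin m) F) E).toSubring
  have hR : IsIntegrallyClosedIn R E :=
    inferInstanceAs (IsIntegrallyClosedIn (integralClosure (MvPolynomial (Fin m) F) E) E)
  have hφR : ∀ p, φ p ∈ R := fun p =>
    (integralClosure (MvPolynomial (Fin m) F) E).algebraMap_mem p
  -- An element outside an integrally closed subring is excluded by some valuation ring containing
  -- that subring.
  obtain ⟨V, hRV, hjV⟩ := Subring.exists_le_valuationSubring_of_isIntegrallyClosedIn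
    (R := R) (x := x j) hj
  have hFR : ∀ c : F, algebraMap F E c ∈ R := fun c => by simpa [φ] using hφR (C c)
  -- Elements of `K` are algebraic over `F`, hence lie in `R`; applied to inverses as well, this
  -- makes the valuation trivial on `K`.
  have hK : ∀ c : K, V.valuation (algebraMap K E c) ≤ 1 := by
    intro c
    rw [V.valuation_le_one_iff]
    refine hRV ?_
    refine (Subring.isIntegrallyClosedIn_iff.1 hR) ?_
    obtain ⟨g, hg, hgc⟩ :=
      (Algebra.IsIntegral.isIntegral (R := F) c).map (IsScalarTower.toAlgHom F K E)
    refine ⟨g.map ((algebraMap F E).codRestrict R hFR), hg.map _, ?_⟩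
    rw [Polynomial.eval₂_map]
    exact hgc
  have hK1 : ∀ c : K, c ≠ 0 → V.valuation (algebraMap K E c) = 1 := by
    intro c hc
    refine le_antisymm (hK c) ?_
    have h1 := hK c⁻¹
    rw [map_inv₀, map_inv₀] at h1
    exact (inv_le_one₀ (zero_lt_iff.2 (by simpa using hc))).1 h1
  obtain ⟨w, hw, s, hs, hsw⟩ := exists_card_eq_of_regular V.valuation (F := F)
    (fun c => by rw [IsScalarTower.algebraMap_apply F K E]; exact hK _) hkn M hM
    (fun j => x j ^ e j) (fun i => by
      rw [V.valuation_le_one_iff]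
      refine hRV ?_
      simpa [φ, dklPoly] using hφR (X i)) j (by
      rw [map_pow]
      exact one_lt_pow₀ (lt_of_not_ge fun h => hjV ((V.valuation_le_one_iff _).1 h))
        (by have := he j; omega))
  let ι : Fin (k + 1) → Fin n := fun i => s.orderEmbOfFin hs i
  have hι : Function.Injective ι := (s.orderEmbOfFin hs).injective
  obtain ⟨P, hP, hPd, hP0⟩ := hrel ι hι
  refine aeval_ne_zero_of_valuation_pow_eq V.valuation hK1 (x ∘ ι) (e ∘ ι)
    (fun a b hab => hcop (hι.ne hab)) hw (fun i => ?_) P hP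
    (fun i => lt_of_le_of_lt hPd (he _)) hP0
  rw [← hsw (ι i) (s.orderEmbOfFin_mem hs i), map_pow]
  rfl

end Integrality

/-! ### Varieties and prime ideals over an algebraically closed field. -/

section Dictionary

variable {K : Type*} [Field K] {n : ℕ}

theorem IsAffineVariety.zeroLocus_vanishingIdeal {V : Set (Fin n → K)} (hV : IsAffineVariety V) :
    zeroLocus K (vanishingIdeal K V) = V := by
  obtain ⟨I, rfl⟩ := hV
  exact zeroLocus_vanishingIdeal_galoisConnection.l_u_l_eq_l I

theorem IsIrreducibleVariety.isPrime_vanishingIdeal {W : Set (Fin n → K)}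
    (hW : IsIrreducibleVariety W) : (vanishingIdeal K W).IsPrime := by
  obtain ⟨hWa, ⟨x, hx⟩, hirr⟩ := hW
  refine ⟨?_, ?_⟩
  · rw [Ideal.ne_top_iff_one]
    intro h
    simpa using h x hx
  · intro f g hfg
    let Z : MvPolynomial (Fin n) K → Set (Fin n → K) := fun f =>
      zeroLocus K (vanishingIdeal K W ⊔ Ideal.span {f})
    have hZ : ∀ f y, y ∈ Z f ↔ y ∈ W ∧ aeval y f = 0 := by
      intro f y
      constructor
      · intro hy
        refine ⟨?_, hy f (Ideal.mem_sup_right (Ideal.mem_span_singleton_self f))⟩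
        rw [← hWa.zeroLocus_vanishingIdeal]
        exact zeroLocus_anti_mono le_sup_left hy
      · rintro ⟨hy, hf⟩ p hp
        have : vanishingIdeal K W ⊔ Ideal.span {f} ≤ vanishingIdeal K {y} :=
          sup_le (vanishingIdeal_anti_mono (Set.singleton_subset_iff.2 hy))
            ((Ideal.span_singleton_le_iff_mem _).2 ((mem_vanishingIdeal_singleton_iff _ _).2 hf))
        exact this hp y rfl
    have hU : W = Z f ∪ Z g := by
      ext y
      rw [Set.mem_union, hZ, hZ]
      refine ⟨fun hy => ?_, fun h => h.elim And.left And.left⟩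
      have h0 := hfg y hy
      rw [map_mul, mul_eq_zero] at h0
      exact h0.imp (⟨hy, ·⟩) (⟨hy, ·⟩)
    refine (hirr _ _ ⟨_, rfl⟩ ⟨_, rfl⟩ hU).imp (fun h y hy => ?_) (fun h y hy => ?_)
    · rw [← h] at hy; exact ((hZ _ _).1 hy).2
    · rw [← h] at hy; exact ((hZ _ _).1 hy).2

variable [IsAlgClosed K]

theorem isIrreducibleVariety_zeroLocus (Q : Ideal (MvPolynomial (Fin n) K)) [hQ : Q.IsPrime] :
    IsIrreducibleVariety (zeroLocus K Q) := by
  have hIQ : vanishingIdeal K (zeroLocus K Q) = Q := IsPrime.vanishingIdeal_zeroLocus Q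
  refine ⟨⟨Q, rfl⟩, ?_, ?_⟩
  · rw [Set.nonempty_iff_ne_empty]
    intro h
    rw [h, vanishingIdeal_empty] at hIQ
    exact hQ.ne_top hIQ.symm
  · intro V₁ V₂ h₁ h₂ h
    have hle : vanishingIdeal K V₁ ⊓ vanishingIdeal K V₂ ≤ Q := by
      rintro p ⟨hp₁, hp₂⟩
      rw [← hIQ]
      intro x hx
      rw [h] at hx
      exact hx.elim (hp₁ x) (hp₂ x)
    refine (hQ.inf_le.1 hle).imp (fun hl => ?_) (fun hl => ?_)
    · refine Set.Subset.antisymm (by rw [h]; exact Set.subset_union_left) ?_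
      rw [← h₁.zeroLocus_vanishingIdeal]
      exact zeroLocus_anti_mono hl
    · refine Set.Subset.antisymm (by rw [h]; exact Set.subset_union_right) ?_
      rw [← h₂.zeroLocus_vanishingIdeal]
      exact zeroLocus_anti_mono hl

/-- Irreducible subvarieties of `V(I)` correspond to the prime ideals containing `I`. -/
def irreducibleSubvarietyOrderIso (I : Ideal (MvPolynomial (Fin n) K)) :
    {W : Set (Fin n → K) // IsIrreducibleVariety W ∧ W ⊆ zeroLocus K I} ≃o
      (PrimeSpectrum.zeroLocus (I : Set (MvPolynomial (Fin n) K)))ᵒᵈ where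
  toFun W := OrderDual.toDual ⟨⟨vanishingIdeal K W.1, W.2.1.isPrime_vanishingIdeal⟩,
    le_zeroLocus_iff_le_vanishingIdeal.1 W.2.2⟩
  invFun P := ⟨zeroLocus K (OrderDual.ofDual P).1.asIdeal,
    isIrreducibleVariety_zeroLocus _, zeroLocus_anti_mono (OrderDual.ofDual P).2⟩
  left_inv W := Subtype.ext W.2.1.1.zeroLocus_vanishingIdeal
  right_inv P := by
    refine OrderDual.ofDual.injective (Subtype.ext (PrimeSpectrum.ext ?_))
    exact IsPrime.vanishingIdeal_zeroLocus _
  map_rel_iff' := by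
    intro W₁ W₂
    refine ⟨fun h => ?_, fun h => vanishingIdeal_anti_mono h⟩
    have h' : vanishingIdeal K W₂.1 ≤ vanishingIdeal K W₁.1 := h
    have := zeroLocus_anti_mono (K := K) h'
    rwa [W₁.2.1.1.zeroLocus_vanishingIdeal, W₂.2.1.1.zeroLocus_vanishingIdeal] at this

theorem dimension_zeroLocus (I : Ideal (MvPolynomial (Fin n) K)) :
    dimension (zeroLocus K I) = ringKrullDim (MvPolynomial (Fin n) K ⧸ I) := by
  rw [dimension, ringKrullDim_quotient, Order.krullDim_eq_of_orderIso
    (irreducibleSubvarietyOrderIso I), Order.krullDim_orderDual]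

theorem zeroLocus_mem_components {I Q : Ideal (MvPolynomial (Fin n) K)}
    (hQ : Q ∈ I.minimalPrimes) : zeroLocus K Q ∈ components (zeroLocus K I) := by
  have := hQ.1.1
  refine ⟨⟨isIrreducibleVariety_zeroLocus Q, zeroLocus_anti_mono hQ.1.2⟩, ?_⟩
  intro Z hZ hQZ
  have h1 : vanishingIdeal K Z ≤ Q := by
    rw [← IsPrime.vanishingIdeal_zeroLocus (K := K) Q]
    exact vanishingIdeal_anti_mono hQZ
  have h2 := hQ.2 ⟨hZ.1.isPrime_vanishingIdeal, le_zeroLocus_iff_le_vanishingIdeal.1 hZ.2⟩ h1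
  rw [← hZ.1.1.zeroLocus_vanishingIdeal]
  exact zeroLocus_anti_mono h2

/-- Needed because `degree` is a `finsum`: only for finitely many components is it an honest sum,
which bounds each summand. -/
theorem finite_components (I : Ideal (MvPolynomial (Fin n) K)) :
    (components (zeroLocus K I)).Finite := by
  refine ((Ideal.finite_minimalPrimes_of_isNoetherianRing _ I).image (zeroLocus K)).subset ?_
  intro W hW
  have hp := hW.1.1.isPrime_vanishingIdeal
  refine ⟨vanishingIdeal K W, ⟨⟨hp, le_zeroLocus_iff_le_vanishingIdeal.1 hW.1.2⟩, ?_⟩,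
    hW.1.1.1.zeroLocus_vanishingIdeal⟩
  intro J hJ hJW
  have := hJ.1
  have h1 := hW.2 ⟨isIrreducibleVariety_zeroLocus J, zeroLocus_anti_mono hJ.2⟩
    (le_zeroLocus_iff_le_vanishingIdeal.2 hJW)
  have h2 := vanishingIdeal_anti_mono (k := K) h1
  rwa [IsPrime.vanishingIdeal_zeroLocus] at h2

/-- On every component of a variety of degree at most `d`, linear sections of complementary
dimension in general position have at most `d` points. -/
theorem exists_isGenericSectionCard {I Q : Ideal (MvPolynomial (Fin n) K)}
    (hQ : Q ∈ I.minimalPrimes) {d : ℕ} (hd : degree (zeroLocus K I) ≤ d) :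
    ∃ (r : ℕ) (δ : ℕ∞), ringKrullDim (MvPolynomial (Fin n) K ⧸ Q) = r ∧ δ ≤ d ∧
      IsGenericSectionCard (zeroLocus K Q) r δ := by
  have h1 : irreducibleDegree (zeroLocus K Q) ≤ d := by
    refine le_trans ?_ hd
    rw [degree, finsum_mem_eq_finite_toFinset_sum _ (finite_components I)]
    exact Finset.single_le_sum (f := irreducibleDegree) (fun _ _ => zero_le)
      ((finite_components I).mem_toFinset.2 (zeroLocus_mem_components hQ))
  -- The infimum of the empty set is `⊤`, so the finite degree bound forces a generic count to
  -- exist.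
  have hne : {δ : ℕ∞ | ∃ r : ℕ, dimension (zeroLocus K Q) = r ∧
      IsGenericSectionCard (zeroLocus K Q) r δ}.Nonempty := by
    by_contra h
    rw [Set.not_nonempty_iff_eq_empty] at h
    rw [irreducibleDegree, h, sInf_empty] at h1
    exact absurd h1 (by simp)
  obtain ⟨r, hr, hG⟩ := csInf_mem hne
  exact ⟨r, _, by rw [← dimension_zeroLocus, hr], h1, hG⟩

end Dictionary

/-! ### Substituting univariate polynomials of degree at most one. -/

section Substitution

/-- Over an infinite domain a nonzero polynomial does not vanish everywhere. -/
theorem exists_eval_ne_zero {R σ : Type*} [CommRing R] [IsDomain R] [Infinite R]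
    {p : MvPolynomial σ R} (hp : p ≠ 0) : ∃ x : σ → R, eval x p ≠ 0 := by
  by_contra! h
  exact hp (MvPolynomial.funext fun x => by rw [h x, map_zero])

theorem ne_zero_of_eval_ne_zero {R σ : Type*} [CommSemiring R] {p : MvPolynomial σ R} {x : σ → R}
    (h : eval x p ≠ 0) : p ≠ 0 := by
  rintro rfl
  simp at h

/-- A product of powers of polynomials of degree at most one. -/
theorem natDegree_prod_pow_le_and_coeff {R σ : Type*} [CommRing R] (f : σ → Polynomial R)
    (hf : ∀ i, (f i).natDegree ≤ 1) (α : σ → ℕ) (s : Finset σ) :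
    (∏ i ∈ s, f i ^ α i).natDegree ≤ ∑ i ∈ s, α i ∧
      (∏ i ∈ s, f i ^ α i).coeff (∑ i ∈ s, α i) = ∏ i ∈ s, (f i).coeff 1 ^ α i := by
  classical
  induction s using Finset.induction_on with
  | empty => simp
  | insert a s ha ih =>
    have h1 : (f a ^ α a).natDegree ≤ α a := by
      simpa using Polynomial.natDegree_pow_le_of_le (α a) (hf a)
    have h2 : (f a ^ α a).coeff (α a) = (f a).coeff 1 ^ α a := by
      simpa using Polynomial.coeff_pow_of_natDegree_le (m := α a) (hf a)
    rw [Finset.prod_insert ha, Finset.sum_insert ha, Finset.prod_insert ha]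
    refine ⟨Polynomial.natDegree_mul_le_of_le h1 ih.1, ?_⟩
    rw [Polynomial.coeff_mul_add_eq_of_natDegree_le h1 ih.1, h2, ih.2]

variable {K R σ : Type*} [Field K] [CommRing R] [Algebra K R] [Fintype σ]

/-- Substituting polynomials of degree at most one into a polynomial of total degree `D` gives a
polynomial of degree at most `D`. -/
theorem natDegree_aeval_le (f : σ → Polynomial R) (hf : ∀ i, (f i).natDegree ≤ 1)
    (P : MvPolynomial σ K) : (aeval f P).natDegree ≤ P.totalDegree := by
  rw [aeval_def, eval₂_eq']
  refine Polynomial.natDegree_sum_le_of_forall_le _ _ fun α hα => ?_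
  rw [Polynomial.algebraMap_apply]
  refine (Polynomial.natDegree_C_mul_le _ _).trans ?_
  refine (natDegree_prod_pow_le_and_coeff f hf α Finset.univ).1.trans ?_
  rw [← Finsupp.degree_eq_sum]
  exact le_totalDegree hα

/-- The leading coefficient after substituting polynomials of degree at most one is the value of
the leading form. -/
theorem coeff_aeval_totalDegree (f : σ → Polynomial R) (hf : ∀ i, (f i).natDegree ≤ 1)
    (P : MvPolynomial σ K) : (aeval f P).coeff P.totalDegree =
      aeval (fun i => (f i).coeff 1) (homogeneousComponent P.totalDegree P) := by
  rw [aeval_def, eval₂_eq', Polynomial.finsetSum_coeff, homogeneousComponent_apply, map_sum,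
    Finset.sum_filter]
  refine Finset.sum_congr rfl fun α hα => ?_
  have h := natDegree_prod_pow_le_and_coeff f hf α Finset.univ
  rw [← Finsupp.degree_eq_sum] at h
  rw [Polynomial.algebraMap_apply, Polynomial.coeff_C_mul]
  split_ifs with hd
  · rw [← hd, h.2, aeval_monomial, Finsupp.prod_fintype _ _ (by simp)]
  · have hlt : α.degree < P.totalDegree := lt_of_le_of_ne (le_totalDegree hα) hd
    rw [Polynomial.coeff_eq_zero_of_natDegree_lt (h.1.trans_lt hlt), mul_zero]

/-- The chain rule for substituting univariate polynomials. -/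
theorem derivative_aeval (f : σ → Polynomial R) (P : MvPolynomial σ K) :
    Polynomial.derivative (aeval f P) =
      ∑ i, Polynomial.derivative (f i) * aeval f (pderiv i P) := by
  classical
  induction P using MvPolynomial.induction_on with
  | C a => simp [Polynomial.algebraMap_apply]
  | add p q hp hq => simp [hp, hq, mul_add, Finset.sum_add_distrib]
  | mul_X p i hp =>
    simp only [map_mul, aeval_X, Polynomial.derivative_mul, hp, pderiv_mul, map_add, pderiv_X,
      mul_add, Finset.sum_add_distrib, Finset.sum_mul]
    congr 1
    · exact Finset.sum_congr rfl fun j _ => by ring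
    · rw [Finset.sum_eq_single i]
      · simp; ring
      · intro j _ hj
        simp [hj.symm]
      · simp

end Substitution

/-! ### Shears that make a relation monic in one variable. -/

section Shift

variable {K : Type*} [Field K] {s : ℕ}

/-- A nonzero form remains nonzero when the first variable is set equal to `1`. -/
theorem aeval_cons_one_ne_zero [Infinite K] {H : MvPolynomial (Fin (s + 1)) K} {D : ℕ}
    (hH : H.IsHomogeneous D) (h0 : H ≠ 0) :
    (aeval (Fin.cons 1 X : Fin (s + 1) → MvPolynomial (Fin s) K) H) ≠ 0 := by
  -- A point with `w 0 ≠ 0` off the zeros of `H` can be scaled to first coordinate 1.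
  obtain ⟨w, hw⟩ := exists_eval_ne_zero (mul_ne_zero h0 (X_ne_zero (R := K) (0 : Fin (s + 1))))
  rw [map_mul, eval_X, mul_ne_zero_iff] at hw
  refine ne_zero_of_eval_ne_zero (x := fun i => w i.succ / w 0) ?_
  have h1 : eval (fun i => w i.succ / w 0)
      (aeval (Fin.cons 1 X : Fin (s + 1) → MvPolynomial (Fin s) K) H) =
        eval (fun i => w i / w 0) H := by
    rw [← coe_aeval_eq_eval, ← coe_aeval_eq_eval, RingHom.coe_coe, RingHom.coe_coe,
      ← AlgHom.comp_apply]
    congr 1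
    ext i
    refine Fin.cases ?_ (fun i => ?_) i
    · simp [hw.2]
    · simp
  have h2 : eval w H = w 0 ^ D * eval (fun i => w i / w 0) H := by
    rw [eval_eq', eval_eq', Finset.mul_sum]
    refine Finset.sum_congr rfl fun α hα => ?_
    have hα' : ∑ i, α i = D := by
      rw [← Finsupp.degree_eq_sum]; exact (hH.degree_eq_sum_deg_support hα).symm
    rw [← hα', ← Finset.prod_pow_eq_pow_sum, mul_left_comm, ← Finset.prod_mul_distrib]
    congr 1
    refine Finset.prod_congr rfl fun i _ => ?_
    rw [div_pow, mul_div_cancel₀ _ (pow_ne_zero _ hw.2)]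
  rw [h1]
  intro h
  rw [h, mul_zero] at h2
  exact hw.1 h2

/-- The substitution `X₀ ↦ T`, `Xᵢ ↦ Xᵢ + vᵢ T`, as an isomorphism with polynomials in `T`. -/
def shiftEquiv (v : Fin s → K) :
    MvPolynomial (Fin (s + 1)) K ≃ₐ[K] Polynomial (MvPolynomial (Fin s) K) :=
  (AlgEquiv.ofAlgHom
    (aeval (Fin.cons (X 0) fun i => X i.succ + C (v i) * X 0) :
      MvPolynomial (Fin (s + 1)) K →ₐ[K] MvPolynomial (Fin (s + 1)) K)
    (aeval (Fin.cons (X 0) fun i => X i.succ - C (v i) * X 0))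
    (by ext i : 1; refine Fin.cases ?_ (fun i => ?_) i <;> simp [algebraMap_eq])
    (by ext i : 1; refine Fin.cases ?_ (fun i => ?_) i <;> simp [algebraMap_eq])).trans
  (finSuccEquiv K s)

theorem shiftEquiv_apply (v : Fin s → K) (P : MvPolynomial (Fin (s + 1)) K) :
    shiftEquiv v P = aeval (Fin.cons Polynomial.X fun i =>
      Polynomial.C (X i) + Polynomial.C (C (v i)) * Polynomial.X) P := by
  change (shiftEquiv v).toAlgHom P = _
  congr 1
  ext i : 1
  refine Fin.cases ?_ (fun i => ?_) i
  · simp [shiftEquiv, finSuccEquiv_X_zero]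
  · simp [shiftEquiv, finSuccEquiv_apply]

theorem natDegree_shift_le (v : Fin s → K) (i : Fin (s + 1)) :
    ((Fin.cons Polynomial.X fun i => Polynomial.C (X i) + Polynomial.C (C (v i)) * Polynomial.X :
      Fin (s + 1) → Polynomial (MvPolynomial (Fin s) K)) i).natDegree ≤ 1 := by
  refine Fin.cases ?_ (fun i => ?_) i
  · exact Polynomial.natDegree_X_le
  · simp only [Fin.cons_succ]
    compute_degree

theorem natDegree_shiftEquiv_le (v : Fin s → K) (P : MvPolynomial (Fin (s + 1)) K) :
    (shiftEquiv v P).natDegree ≤ P.totalDegree := by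
  rw [shiftEquiv_apply]
  exact natDegree_aeval_le _ (natDegree_shift_le v) P

/-- The top coefficient is a scalar, so the shifted relation is monic up to a unit as soon as its
leading form is nonzero at `(1, v)`. -/
theorem coeff_shiftEquiv (v : Fin s → K) (P : MvPolynomial (Fin (s + 1)) K) :
    (shiftEquiv v P).coeff P.totalDegree =
      C (eval (Fin.cons 1 v) (homogeneousComponent P.totalDegree P)) := by
  rw [shiftEquiv_apply, coeff_aeval_totalDegree _ (natDegree_shift_le v) P,
    ← algebraMap_eq, ← coe_aeval_eq_eval, RingHom.coe_coe]
  change _ = ((Algebra.ofId K (MvPolynomial (Fin s) K)).comp (aeval (Fin.cons 1 v))) _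
  congr 1
  ext i : 1
  refine Fin.cases ?_ (fun i => ?_) i
  · simp
  · simp [Polynomial.coeff_C, algebraMap_eq, Algebra.ofId_apply]

/-- Differentiating in `T` is differentiating along `(1, v)`; this reduces separability to a choice
of direction. -/
theorem derivative_shiftEquiv (v : Fin s → K) (P : MvPolynomial (Fin (s + 1)) K) :
    Polynomial.derivative (shiftEquiv v P) =
      shiftEquiv v (∑ i, C ((Fin.cons 1 v : Fin (s + 1) → K) i) * pderiv i P) := by
  rw [shiftEquiv_apply, derivative_aeval, map_sum]
  refine Finset.sum_congr rfl fun i _ => ?_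
  rw [map_mul, shiftEquiv_apply, shiftEquiv_apply]
  congr 1
  refine Fin.cases ?_ (fun i => ?_) i
  · simp
  · simp [Polynomial.algebraMap_apply, algebraMap_eq]

/-- Evaluation of the shifted polynomial. -/
theorem eval₂_shiftEquiv {B : Type*} [CommRing B] [Algebra K B] (v : Fin s → K) (y₀ : B)
    (y : Fin s → B) (P : MvPolynomial (Fin (s + 1)) K) :
    (shiftEquiv v P).eval₂ (aeval y : MvPolynomial (Fin s) K →ₐ[K] B).toRingHom y₀ =
      aeval (Fin.cons y₀ fun i => y i + v i • y₀) P := by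
  rw [shiftEquiv_apply]
  let φ : Polynomial (MvPolynomial (Fin s) K) →ₐ[K] B :=
    { Polynomial.eval₂RingHom (aeval y : MvPolynomial (Fin s) K →ₐ[K] B).toRingHom y₀ with
      commutes' := fun c => by simp [Polynomial.algebraMap_apply] }
  change φ _ = _
  rw [← AlgHom.comp_apply]
  congr 1
  ext i : 1
  refine Fin.cases ?_ (fun i => ?_) i
  · simp [φ]
  · simp [φ, Algebra.smul_def]

/-- A relation whose leading form does not vanish at `(1, v)` is an equation of integral dependence
of `y₀` over the `yᵢ - vᵢ y₀`. -/
theorem isIntegralElem_of_shift {B : Type*} [CommRing B] [Algebra K B] (v : Fin s → K) (y₀ : B)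
    (y : Fin s → B) (P : MvPolynomial (Fin (s + 1)) K)
    (hP : aeval (Fin.cons y₀ y : Fin (s + 1) → B) P = 0)
    (hv : eval (Fin.cons 1 v) (homogeneousComponent P.totalDegree P) ≠ 0) :
    (aeval (fun i => y i - v i • y₀) : MvPolynomial (Fin s) K →ₐ[K] B).toRingHom.IsIntegralElem
      y₀ := by
  set c := eval (Fin.cons 1 v) (homogeneousComponent P.totalDegree P) with hc
  refine ⟨Polynomial.C (C c⁻¹) * shiftEquiv v P, ?_, ?_⟩
  · refine Polynomial.monic_of_natDegree_le_of_coeff_eq_one P.totalDegree ?_ ?_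
    · exact (Polynomial.natDegree_C_mul_le _ _).trans (natDegree_shiftEquiv_le v P)
    · rw [Polynomial.coeff_C_mul, coeff_shiftEquiv, ← hc, ← C_mul, inv_mul_cancel₀ hv, C_1]
  · rw [Polynomial.eval₂_mul, eval₂_shiftEquiv]
    simp [hP]

end Shift

/-! ### Linear Noether normalization with general coefficients. -/

section Normalization

/-- An injective integral ring homomorphism does not lower the Krull dimension. -/
theorem ringKrullDim_le_of_isIntegral_of_injective {R S : Type*} [CommRing R] [CommRing S]
    (f : R →+* S) (hf : f.IsIntegral) (hinj : Function.Injective f) :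
    ringKrullDim R ≤ ringKrullDim S := by
  let := f.toAlgebra
  have : Algebra.IsIntegral R S := ⟨hf⟩
  refine iSup_le fun l => ?_
  obtain ⟨Q, -, hQ, hQl⟩ := Ideal.exists_ideal_over_prime_of_isIntegral (S := S) l.head.asIdeal ⊥
    (by
      rw [← RingHom.ker_eq_comap_bot, (RingHom.injective_iff_ker_eq_bot (algebraMap R S)).1 hinj]
      exact bot_le)
  have : Q.LiesOver (RelSeries.head l).asIdeal := ⟨hQl.symm⟩
  obtain ⟨l', hl', -⟩ := Ideal.exists_ltSeries_of_hasGoingUp (S := S) l Q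
  rw [← hl']
  exact Order.LTSeries.length_le_krullDim l'

variable {K B : Type*} [Field K] [CommRing B] [Algebra K B]

theorem homogeneousComponent_totalDegree_ne_zero {σ : Type*} {P : MvPolynomial σ K} (hP : P ≠ 0) :
    homogeneousComponent P.totalDegree P ≠ 0 := by
  obtain ⟨α, hα, hd⟩ := Finset.exists_mem_eq_sup P.support
    (by simpa [Finset.nonempty_iff_ne_empty] using hP) Finsupp.degree
  intro h
  have h1 := congrArg (coeff α) h
  rw [coeff_homogeneousComponent, if_pos (show α.degree = P.totalDegree from hd.symm),
    coeff_zero] at h1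
  exact mem_support_iff.1 hα h1

/-- A linear system whose matrix has a nonzero maximal minor is solvable. -/
theorem exists_mulVec_eq {r s : ℕ} (hrs : r ≤ s) (A : Matrix (Fin r) (Fin s) K)
    (hA : (A.submatrix id (Fin.castLE hrs)).det ≠ 0) (b : Fin r → K) :
    ∃ v : Fin s → K, A.mulVec v = b := by
  let J : Matrix (Fin s) (Fin r) K := (1 : Matrix (Fin s) (Fin s) K).submatrix id (Fin.castLE hrs)
  have hJ : A.submatrix id (Fin.castLE hrs) = A * J := by
    ext i j
    simp [J, Matrix.mul_apply, Matrix.one_apply]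
  refine ⟨J.mulVec ((A * J)⁻¹.mulVec b), ?_⟩
  rw [Matrix.mulVec_mulVec, Matrix.mulVec_mulVec, Matrix.mul_nonsing_inv _ (by
    rw [← hJ]; simpa using hA), Matrix.one_mulVec]

/-- Transitivity of integrality over subalgebras given by generators. -/
theorem isIntegral_aeval_of_forall {n r : ℕ} (x : Fin n → B) (y : Fin r → B)
    (hx : (aeval x : MvPolynomial (Fin n) K →ₐ[K] B).toRingHom.IsIntegral)
    (hy : ∀ j, (aeval y : MvPolynomial (Fin r) K →ₐ[K] B).toRingHom.IsIntegralElem (x j)) :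
    (aeval y : MvPolynomial (Fin r) K →ₐ[K] B).toRingHom.IsIntegral := by
  intro b
  let := (aeval y : MvPolynomial (Fin r) K →ₐ[K] B).toRingHom.toAlgebra
  let S := integralClosure (MvPolynomial (Fin r) K) B
  have hS : ∀ p : MvPolynomial (Fin n) K, aeval x p ∈ S := by
    intro p
    induction p using MvPolynomial.induction_on with
    | C a =>
      have h : algebraMap (MvPolynomial (Fin r) K) B (C a) ∈ S := S.algebraMap_mem _
      have h' : algebraMap (MvPolynomial (Fin r) K) B (C a) = algebraMap K B a :=
        aeval_C y a
      rwa [h', ← aeval_C x a] at h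
    | add p q hp hq => rw [map_add]; exact S.add_mem hp hq
    | mul_X p i hp => rw [map_mul, aeval_X]; exact S.mul_mem hp (hy i)
  obtain ⟨g, hg, hgb⟩ := hx b
  have hbS : IsIntegral S b := by
    refine ⟨g.map ((aeval x : MvPolynomial (Fin n) K →ₐ[K] B).toRingHom.codRestrict S hS),
      hg.map _, ?_⟩
    rw [Polynomial.eval₂_map]
    exact hgb
  exact isIntegral_trans b hbS

/-- **Linear Noether normalization**, with coefficients in general position: if `B` is integral
over `n` elements and of dimension at most `r ≤ n`, then it is integral over `r` linear
combinations of them, whose coefficients avoid the zeros of any given nonzero polynomial. -/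
theorem exists_isIntegral_linear [Infinite K] {r : ℕ} (hdim : ringKrullDim B ≤ r) {n : ℕ}
    (hrn : r ≤ n) (x : Fin n → B)
    (hx : (aeval x : MvPolynomial (Fin n) K →ₐ[K] B).toRingHom.IsIntegral)
    (H : MvPolynomial (Fin r × Fin n) K) (hH : H ≠ 0) :
    ∃ C : Matrix (Fin r) (Fin n) K, eval (fun p => C p.1 p.2) H ≠ 0 ∧
      (aeval (fun i => ∑ j, C i j • x j) :
        MvPolynomial (Fin r) K →ₐ[K] B).toRingHom.IsIntegral := by
  induction n, hrn using Nat.le_induction with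
  | base =>
    obtain ⟨c, hc⟩ := exists_eval_ne_zero
      (mul_ne_zero hH (Matrix.det_mvPolynomialX_ne_zero (Fin r) K))
    rw [map_mul, mul_ne_zero_iff] at hc
    let A : Matrix (Fin r) (Fin r) K := fun i j => c (i, j)
    have hA : A.det ≠ 0 := by
      have := hc.2
      rw [RingHom.map_det] at this
      convert this using 2
      ext i j
      simp [A, Matrix.mvPolynomialX]
    refine ⟨A, hc.1, isIntegral_aeval_of_forall x _ hx fun j => ?_⟩
    have hj : x j = (aeval (fun i => ∑ j, A i j • x j) : MvPolynomial (Fin r) K →ₐ[K] B).toRingHom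
        (∑ i, C (A⁻¹ j i) * X i) := by
      have h1 : ∀ l, ∑ i, A⁻¹ j i * A i l = (1 : Matrix (Fin r) (Fin r) K) j l := by
        intro l
        rw [← Matrix.nonsing_inv_mul A (by simpa using hA), Matrix.mul_apply]
      simp only [AlgHom.toRingHom_eq_coe, map_sum, map_mul, RingHom.coe_coe, aeval_C, aeval_X,
        ← Algebra.smul_def, Finset.smul_sum, smul_smul]
      rw [Finset.sum_comm]
      simp only [← Finset.sum_smul, h1, Matrix.one_apply]
      simp
    rw [hj]
    exact RingHom.isIntegralElem_map _
  | succ s hrs ih =>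
    have hdep : ¬ AlgebraicIndependent K x := by
      intro h
      have h1 := (ringKrullDim_le_of_isIntegral_of_injective _ hx h).trans hdim
      rw [MvPolynomial.ringKrullDim_of_isNoetherianRing, ringKrullDim_eq_zero_of_field, zero_add,
        Nat.card_eq_fintype_card, Fintype.card_fin] at h1
      have h2 : s + 1 ≤ r := by exact_mod_cast h1
      omega
    rw [algebraicIndependent_iff] at hdep
    push Not at hdep
    obtain ⟨P, hP, hP0⟩ := hdep
    have hT := aeval_cons_one_ne_zero (homogeneousComponent_isHomogeneous _ P)
      (homogeneousComponent_totalDegree_ne_zero hP0)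
    -- Combinations of the `x (j + 1) - v j • x 0` with matrix `A` have coefficient matrix `(-Av |
    -- A)` in the `x j`. `Hv` is `H` at this matrix, with both `A` and `v` indeterminate.
    let Hv : MvPolynomial ((Fin r × Fin s) ⊕ Fin s) K := aeval (fun p : Fin r × Fin (s + 1) =>
      (Fin.cons (-∑ j, X (Sum.inl (p.1, j)) * X (Sum.inr j)) (fun j => X (Sum.inl (p.1, j))) :
        Fin (s + 1) → MvPolynomial ((Fin r × Fin s) ⊕ Fin s) K) p.2) H
    have hHv_eval : ∀ (A : Fin r × Fin s → K) (v : Fin s → K), eval (Sum.elim A v) Hv =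
        eval (fun p : Fin r × Fin (s + 1) => (Fin.cons (-∑ j, A (p.1, j) * v j)
          (fun j => A (p.1, j)) : Fin (s + 1) → K) p.2) H := by
      intro A v
      rw [← coe_aeval_eq_eval, ← coe_aeval_eq_eval, RingHom.coe_coe, RingHom.coe_coe,
        ← AlgHom.comp_apply]
      congr 1
      ext ⟨i, j⟩
      refine Fin.cases ?_ (fun j => ?_) j <;> simp
    -- A general matrix has the form `(-Av | A)`: as `r ≤ s`, its columns after the first have a
    -- nonzero maximal minor, and `v` solves a linear system.
    have hHv : Hv ≠ 0 := by
      let ρ : Fin r × Fin r → Fin r × Fin (s + 1) := fun p => (p.1, (Fin.castLE hrs p.2).succ)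
      have hρ : Function.Injective ρ := by
        rintro ⟨i, j⟩ ⟨i', j'⟩ h
        simpa [ρ] using h
      obtain ⟨c, hc⟩ := exists_eval_ne_zero (mul_ne_zero hH ((map_ne_zero_iff (rename ρ)
        (rename_injective _ hρ)).2 (Matrix.det_mvPolynomialX_ne_zero (Fin r) K)))
      rw [map_mul, mul_ne_zero_iff, eval_rename, Matrix.eval_det_mvPolynomialX] at hc
      obtain ⟨v, hv⟩ := exists_mulVec_eq hrs (Matrix.of fun i j => c (i, Fin.succ j)) hc.2
        (fun i => -c (i, 0))
      refine ne_zero_of_eval_ne_zero (x := Sum.elim (fun p => c (p.1, p.2.succ)) v) ?_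
      rw [hHv_eval]
      convert hc.1 using 2
      congr 1
      ext ⟨i, j⟩
      refine Fin.cases ?_ (fun j => ?_) j
      · have := congrFun hv i
        simp only [Matrix.mulVec, dotProduct, Matrix.of_apply] at this
        simp [this]
      · simp
    -- This `v` makes `P` an integral equation for `x 0` and leaves `H` nonzero as a condition on
    -- `A`.
    obtain ⟨z, hz⟩ := exists_eval_ne_zero (mul_ne_zero hHv
      ((map_ne_zero_iff (rename (Sum.inr : Fin s → (Fin r × Fin s) ⊕ Fin s))
        (rename_injective _ Sum.inr_injective)).2 hT))
    rw [map_mul, mul_ne_zero_iff, eval_rename] at hz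
    let v : Fin s → K := z ∘ Sum.inr
    have hz1 : eval (Sum.elim (z ∘ Sum.inl) v) Hv ≠ 0 := by
      rw [Sum.elim_comp_inl_inr]; exact hz.1
    let H' : MvPolynomial (Fin r × Fin s) K := aeval (fun p : Fin r × Fin (s + 1) =>
      (Fin.cons (-∑ j, X (p.1, j) * C (v j)) (fun j => X (p.1, j)) :
        Fin (s + 1) → MvPolynomial (Fin r × Fin s) K) p.2) H
    have hH'_eval : ∀ (A : Fin r × Fin s → K), eval A H' =
        eval (fun p : Fin r × Fin (s + 1) => (Fin.cons (-∑ j, A (p.1, j) * v j)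
          (fun j => A (p.1, j)) : Fin (s + 1) → K) p.2) H := by
      intro A
      rw [← coe_aeval_eq_eval, ← coe_aeval_eq_eval, RingHom.coe_coe, RingHom.coe_coe,
        ← AlgHom.comp_apply]
      congr 1
      ext ⟨i, j⟩
      refine Fin.cases ?_ (fun j => ?_) j <;> simp
    have hH' : H' ≠ 0 := by
      rw [hHv_eval, ← hH'_eval] at hz1
      exact ne_zero_of_eval_ne_zero hz1
    let y : Fin s → B := fun j => x j.succ - v j • x 0
    have hx0 : (aeval y : MvPolynomial (Fin s) K →ₐ[K] B).toRingHom.IsIntegralElem (x 0) := by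
      refine isIntegralElem_of_shift v (x 0) (fun j => x j.succ) P ?_ ?_
      · rw [show (Fin.cons (x 0) fun j => x j.succ : Fin (s + 1) → B) = x from Fin.cons_self_tail x]
        exact hP
      · convert hz.2 using 1
        rw [← coe_aeval_eq_eval, ← coe_aeval_eq_eval, RingHom.coe_coe, RingHom.coe_coe,
          ← AlgHom.comp_apply]
        congr 1
        ext i
        refine Fin.cases ?_ (fun j => ?_) i <;> simp [v]
    have hy : (aeval y : MvPolynomial (Fin s) K →ₐ[K] B).toRingHom.IsIntegral := by
      refine isIntegral_aeval_of_forall x y hx fun j => ?_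
      refine Fin.cases hx0 (fun j => ?_) j
      have hj : x j.succ = (aeval y : MvPolynomial (Fin s) K →ₐ[K] B).toRingHom (X j) +
          (aeval y : MvPolynomial (Fin s) K →ₐ[K] B).toRingHom (C (v j)) * x 0 := by
        simp [y, Algebra.smul_def]
      rw [hj]
      exact (RingHom.isIntegralElem_map _).add _ ((RingHom.isIntegralElem_map _).mul _ hx0)
    obtain ⟨A, hA, hAint⟩ := ih y hy H' hH'
    refine ⟨fun i => Fin.cons (-∑ j, A i j * v j) (A i), ?_, ?_⟩
    · rw [hH'_eval] at hA
      exact hA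
    · convert hAint using 4 with i
      rw [Fin.sum_univ_succ]
      simp [y, smul_sub, Finset.sum_sub_distrib, smul_smul, ← Finset.sum_smul]
      abel

end Normalization

/-! ### Absence of low-degree relations as an open condition. -/

section Independence

/-- Vectors which no nonzero functional annihilates contain a basis: they can be arranged into an
invertible matrix. -/
theorem exists_det_ne_zero {K ι T : Type*} [Field K] [Fintype ι] [DecidableEq ι] (u : T → ι → K)
    (hu : ∀ c : ι → K, (∀ t, ∑ i, u t i * c i = 0) → c = 0) :
    ∃ t : ι → T, (Matrix.of fun i => u (t i)).det ≠ 0 := by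
  have hspan : Submodule.span K (Set.range u) = ⊤ := by
    by_contra h
    obtain ⟨f, hf, hle⟩ := Submodule.exists_le_ker_of_lt_top _ (lt_top_iff_ne_top.2 h)
    apply hf
    have hc := hu (fun i => f (Pi.single i 1)) fun t => by
      have h0 : f (u t) = 0 := hle (Submodule.subset_span ⟨t, rfl⟩)
      rw [pi_eq_sum_univ' (u t), map_sum] at h0
      simpa using h0
    refine LinearMap.pi_ext' fun i => LinearMap.ext_ring ?_
    simpa using congrFun hc i
  obtain ⟨b, hbu, hb, hli⟩ := exists_linearIndependent K (Set.range u)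
  let bas : Module.Basis b K (ι → K) := Module.Basis.mk hli (by
    rw [Subtype.range_coe, hb, hspan])
  let σ : ι ≃ b := (Pi.basisFun K ι).indexEquiv bas
  choose t ht using fun i : ι => hbu (σ i).2
  refine ⟨t, ?_⟩
  have hrow : (Matrix.of fun i => u (t i)) = Matrix.of fun i => ((σ i : b) : ι → K) := by
    ext i j; simp [ht]
  have hli' : LinearIndependent K (fun i => ((σ i : b) : ι → K)) :=
    hli.comp σ σ.injective
  rw [hrow]
  exact ((Matrix.isUnit_iff_isUnit_det _).1
    (Matrix.linearIndependent_rows_iff_isUnit.1 hli')).ne_zero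

variable {K : Type*} [Field K] {n s : ℕ}

/-- The linear forms with coefficient matrix `L` satisfy no nonzero polynomial relation of degree
at most `d` on `W`. -/
def NoRelation (W : Set (Fin n → K)) (d : ℕ) (L : Matrix (Fin s) (Fin n) K) : Prop :=
  ∀ P : MvPolynomial (Fin s) K, P.totalDegree ≤ d → (∀ w ∈ W, eval (L.mulVec w) P = 0) → P = 0

/-- The absence of relations of bounded degree is an open condition on the linear forms. -/
theorem NoRelation.exists_polynomial {W : Set (Fin n → K)} {d : ℕ}
    {L₀ : Matrix (Fin s) (Fin n) K} (h : NoRelation W d L₀) :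
    ∃ N : MvPolynomial (Fin s × Fin n) K, N ≠ 0 ∧
      ∀ L : Matrix (Fin s) (Fin n) K, eval (fun p => L p.1 p.2) N ≠ 0 → NoRelation W d L := by
  classical
  have hfin : {α : Fin s →₀ ℕ | α.degree ≤ d}.Finite := Finsupp.finite_of_degree_le d
  let ι := {α : Fin s →₀ ℕ | α.degree ≤ d}
  have : Fintype ι := hfin.fintype
  let u : Matrix (Fin s) (Fin n) K → W → ι → K := fun L w α => ∏ i, L.mulVec w.1 i ^ α.1 i
  have hsum : ∀ (L : Matrix (Fin s) (Fin n) K) (w : W) (P : MvPolynomial (Fin s) K),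
      P.totalDegree ≤ d → eval (L.mulVec w.1) P = ∑ α, u L w α * P.coeff α.1 := by
    intro L w P hP
    rw [eval_eq', Finset.sum_subset (s₁ := P.support) (s₂ := hfin.toFinset)
      (fun α hα => hfin.mem_toFinset.2 ((le_totalDegree hα).trans hP))
      (fun α _ hα => by rw [notMem_support_iff.1 hα, zero_mul])]
    rw [← Finset.sum_subtype hfin.toFinset (p := fun α => α ∈ {α : Fin s →₀ ℕ | α.degree ≤ d})
      (fun α => hfin.mem_toFinset) (fun α => (∏ i, L.mulVec w.1 i ^ α i) * P.coeff α)]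
    exact Finset.sum_congr rfl fun α _ => mul_comm _ _
  obtain ⟨t, ht⟩ := exists_det_ne_zero (u L₀) fun c hc => by
    let P : MvPolynomial (Fin s) K := ∑ α : ι, monomial α.1 (c α)
    have hPc : ∀ α : ι, P.coeff α.1 = c α := by
      intro α
      simp only [P, coeff_sum, coeff_monomial]
      rw [Finset.sum_eq_single α]
      · simp
      · intro β _ hβ
        rw [if_neg fun h => hβ (Subtype.ext h)]
      · simp
    have hPd : P.totalDegree ≤ d := by
      refine totalDegree_finsetSum_le fun α _ => ?_
      exact (totalDegree_monomial_le _ _).trans α.2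
    have hP0 := h P hPd fun w hw => by
      rw [hsum L₀ ⟨w, hw⟩ P hPd]
      simpa only [hPc] using hc ⟨w, hw⟩
    ext α
    rw [← hPc, hP0, coeff_zero, Pi.zero_apply]
  -- The points `t β` found for `L₀` stay fixed while the forms vary; a nonzero determinant forces
  -- the coefficients of any relation to vanish.
  let N : MvPolynomial (Fin s × Fin n) K := Matrix.det (Matrix.of fun β α : ι =>
    ∏ i, (∑ j, X (i, j) * C ((t β).1 j)) ^ α.1 i)
  have hN : ∀ L : Matrix (Fin s) (Fin n) K, eval (fun p => L p.1 p.2) N =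
      (Matrix.of fun β => u L (t β)).det := by
    intro L
    rw [RingHom.map_det]
    congr 1
    ext β α
    simp [u, Matrix.mulVec, dotProduct]
  refine ⟨N, ne_zero_of_eval_ne_zero (by rw [hN]; exact ht), fun L hL P hPd hP => ?_⟩
  rw [hN] at hL
  have hz := Matrix.eq_zero_of_mulVec_eq_zero hL (v := fun α : ι => P.coeff α.1) (by
    ext β
    simp only [Matrix.mulVec, dotProduct, Matrix.of_apply, Pi.zero_apply]
    rw [← hsum L (t β) P hPd, hP _ (t β).2])
  ext α
  rw [coeff_zero]
  by_cases hα : α.degree ≤ d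
  · exact congrFun hz ⟨α, hα⟩
  · exact coeff_eq_zero_of_totalDegree_lt (lt_of_le_of_lt hPd (not_le.1 hα))

end Independence

/-! ### Points of an integral extension over a general point. -/

section Lifting

/-- The domain case, to which the general one reduces by factoring out the kernel of `θ` and a prime
above it. -/
theorem exists_ringHom_comp_eq_of_injective {R B K : Type*} [CommRing R] [CommRing B] [IsDomain B]
    [Field K] [IsAlgClosed K] (π : R →+* B) (hπ : π.IsIntegral) (hinj : Function.Injective π)
    (θ : R →+* K) (hθ : Function.Injective θ) : ∃ ψ : B →+* K, ψ.comp π = θ := by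
  let := π.toAlgebra
  let := θ.toAlgebra
  have : IsDomain R := hinj.isDomain π
  have : FaithfulSMul R B := (faithfulSMul_iff_algebraMap_injective _ _).2 hinj
  have : FaithfulSMul R K := (faithfulSMul_iff_algebraMap_injective _ _).2 hθ
  have : Algebra.IsIntegral R B := ⟨hπ⟩
  let ψ : B →ₐ[R] K := IsAlgClosed.lift
  exact ⟨ψ.toRingHom, RingHom.ext fun x => ψ.commutes x⟩

/-- Homomorphisms to an algebraically closed field extend along integral ring homomorphisms. -/
theorem exists_ringHom_comp_eq {R B K : Type*} [CommRing R] [CommRing B] [Field K] [IsAlgClosed K]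
    (π : R →+* B) (hπ : π.IsIntegral) (θ : R →+* K) (hθ : RingHom.ker π ≤ RingHom.ker θ) :
    ∃ ψ : B →+* K, ψ.comp π = θ := by
  let := π.toAlgebra
  have : Algebra.IsIntegral R B := ⟨hπ⟩
  have hprime : (RingHom.ker θ).IsPrime := RingHom.ker_isPrime θ
  obtain ⟨N, -, hN, hNθ⟩ := Ideal.exists_ideal_over_prime_of_isIntegral (S := B) (RingHom.ker θ) ⊥
    (by rw [← RingHom.ker_eq_comap_bot]; exact hθ)
  let f : R ⧸ RingHom.ker θ →+* B ⧸ N := Ideal.quotientMap N π hNθ.ge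
  have hf : Function.Injective f := Ideal.quotientMap_injective' hNθ.le
  have hfint : f.IsIntegral := by
    apply RingHom.IsIntegral.tower_top (Ideal.Quotient.mk (RingHom.ker θ)) f
    have : f.comp (Ideal.Quotient.mk (RingHom.ker θ)) = (Ideal.Quotient.mk N).comp π := by
      ext x; rfl
    rw [this]
    exact hπ.trans _ _ (RingHom.isIntegral_of_surjective _ Ideal.Quotient.mk_surjective)
  obtain ⟨ψ, hψ⟩ := exists_ringHom_comp_eq_of_injective f hfint hf (RingHom.kerLift θ)
    (RingHom.kerLift_injective θ)
  refine ⟨ψ.comp (Ideal.Quotient.mk N), ?_⟩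
  ext x
  exact RingHom.congr_fun hψ (Ideal.Quotient.mk (RingHom.ker θ) x)

/-- A separable irreducible monic polynomial over a normal domain stays coprime to its derivative
up to a nonzero constant. -/
theorem exists_bezout_derivative {R : Type*} [CommRing R] [IsDomain R] [IsIntegrallyClosed R]
    (p : Polynomial R) (hmonic : p.Monic) (hp : Irreducible p)
    (hder : Polynomial.derivative p ≠ 0) :
    ∃ (g : R) (u w : Polynomial R), g ≠ 0 ∧
      u * p + w * Polynomial.derivative p = Polynomial.C g := by
  -- By Gauss's lemma `p` stays irreducible over the fraction field, hence is separable there;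
  -- clearing denominators in a Bézout identity leaves the constant `g`.
  let L := FractionRing R
  have hirr : Irreducible (p.map (algebraMap R L)) :=
    (hmonic.irreducible_iff_irreducible_map_fraction_map).1 hp
  have hinj : Function.Injective (algebraMap R L) := IsFractionRing.injective R L
  have hsep : (p.map (algebraMap R L)).Separable := by
    refine (Polynomial.separable_iff_derivative_ne_zero hirr).2 ?_
    rw [Polynomial.derivative_map]
    exact (Polynomial.map_ne_zero_iff hinj).2 hder
  obtain ⟨u, w, huw⟩ := hsep
  obtain ⟨a, ha, hau⟩ := IsLocalization.integerNormalization_spec (nonZeroDivisors R) u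
  obtain ⟨b, hb, hbw⟩ := IsLocalization.integerNormalization_spec (nonZeroDivisors R) w
  set u' := IsLocalization.integerNormalization (nonZeroDivisors R) u
  set w' := IsLocalization.integerNormalization (nonZeroDivisors R) w
  refine ⟨a * b, Polynomial.C b * u', Polynomial.C a * w', mul_ne_zero
    (nonZeroDivisors.ne_zero ha) (nonZeroDivisors.ne_zero hb), ?_⟩
  apply Polynomial.map_injective _ hinj
  simp only [Polynomial.map_add, Polynomial.map_mul, Polynomial.map_C, hau, hbw,
    ← Polynomial.derivative_map, map_mul]
  simp only [← IsScalarTower.algebraMap_smul L a u, ← IsScalarTower.algebraMap_smul L b w,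
    Polynomial.smul_eq_C_mul]
  linear_combination (Polynomial.C (algebraMap R L a) * Polynomial.C (algebraMap R L b)) * huw

variable {K B : Type*} [Field K] [IsAlgClosed K] [CommRing B] [IsDomain B] [Algebra K B] {r : ℕ}

/-- Let `B` be integral over algebraically independent elements `yᵢ` and let `y₀` satisfy an
irreducible separable equation `p` of degree `D` over them. Then over a general point `b` there are
`D` points of `B` with different values of `y₀`. -/
theorem exists_points_of_irreducible (y : Fin r → B)
    (hy : (aeval y : MvPolynomial (Fin r) K →ₐ[K] B).toRingHom.IsIntegral)
    (hind : AlgebraicIndependent K y) (y₀ : B) (p : Polynomial (MvPolynomial (Fin r) K))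
    (hmonic : p.Monic) (hp : Irreducible p) (hder : Polynomial.derivative p ≠ 0)
    (hpy : p.eval₂ (aeval y : MvPolynomial (Fin r) K →ₐ[K] B).toRingHom y₀ = 0) :
    ∃ g : MvPolynomial (Fin r) K, g ≠ 0 ∧ ∀ b : Fin r → K, eval b g ≠ 0 →
      ∃ T : Finset K, T.card = p.natDegree ∧
        ∀ t ∈ T, ∃ ψ : B →ₐ[K] K, (∀ i, ψ (y i) = b i) ∧ ψ y₀ = t := by
  classical
  obtain ⟨g, u, w, hg, huw⟩ := exists_bezout_derivative p hmonic hp hder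
  refine ⟨g, hg, fun b hb => ?_⟩
  let pb : Polynomial K := p.map (eval b)
  have hpb : pb.Monic := hmonic.map _
  have hsep : pb.Separable := by
    have h1 := congrArg (Polynomial.map (eval b)) huw
    rw [Polynomial.map_add, Polynomial.map_mul, Polynomial.map_mul, Polynomial.map_C,
      ← Polynomial.derivative_map] at h1
    refine ⟨Polynomial.C (eval b g)⁻¹ * u.map (eval b), Polynomial.C (eval b g)⁻¹ * w.map (eval b),
      ?_⟩
    rw [mul_assoc, mul_assoc, ← mul_add, h1, ← Polynomial.C_mul, inv_mul_cancel₀ hb,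
      Polynomial.C_1]
  refine ⟨pb.roots.toFinset, ?_, fun t ht => ?_⟩
  · rw [Multiset.toFinset_card_of_nodup (Polynomial.nodup_roots hsep),
      IsAlgClosed.card_roots_eq_natDegree, hmonic.natDegree_map]
  have htroot : p.eval₂ (eval b) t = 0 := by
    rw [Multiset.mem_toFinset, Polynomial.mem_roots hpb.ne_zero, Polynomial.IsRoot,
      Polynomial.eval_map] at ht
    exact ht
  let φ := (aeval y : MvPolynomial (Fin r) K →ₐ[K] B).toRingHom
  let := φ.toAlgebra
  have hinj : Function.Injective (algebraMap (MvPolynomial (Fin r) K) B) := hind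
  have : FaithfulSMul (MvPolynomial (Fin r) K) B :=
    (faithfulSMul_iff_algebraMap_injective _ _).2 hinj
  let π : Polynomial (MvPolynomial (Fin r) K) →+* B := Polynomial.eval₂RingHom φ y₀
  have hπ : π.IsIntegral := by
    apply RingHom.IsIntegral.tower_top Polynomial.C π
    have : π.comp Polynomial.C = φ := by ext x <;> simp [π]
    rw [this]
    exact hy
  let θ : Polynomial (MvPolynomial (Fin r) K) →+* K := Polynomial.eval₂RingHom (eval b) t
  -- By normality of the polynomial ring, `p` is the minimal polynomial of `y₀` up to a unit. It
  -- therefore divides everything in `ker π`, and it vanishes at `(b, t)`.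
  have hker : RingHom.ker π ≤ RingHom.ker θ := by
    intro q hq
    have hm : minpoly (MvPolynomial (Fin r) K) y₀ ∣ p :=
      minpoly.isIntegrallyClosed_dvd (hy y₀) hpy
    have hmq : minpoly (MvPolynomial (Fin r) K) y₀ ∣ q :=
      minpoly.isIntegrallyClosed_dvd (hy y₀) hq
    have hass : Associated (minpoly (MvPolynomial (Fin r) K) y₀) p :=
      (minpoly.irreducible (hy y₀)).associated_of_dvd hp hm
    obtain ⟨q', rfl⟩ := hass.dvd_iff_dvd_left.1 hmq
    rw [RingHom.mem_ker, map_mul]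
    have : θ p = 0 := htroot
    rw [this, zero_mul]
  obtain ⟨ψ, hψ⟩ := exists_ringHom_comp_eq π hπ θ hker
  have hψ' : ∀ q, ψ (π q) = θ q := fun q => by rw [← hψ]; rfl
  refine ⟨{ ψ with commutes' := fun c => ?_ }, fun i => ?_, ?_⟩
  · have := hψ' (Polynomial.C (C c))
    simpa [π, θ, φ] using this
  · have := hψ' (Polynomial.C (X i))
    simpa [π, θ, φ] using this
  · have := hψ' Polynomial.X
    simpa [π, θ, φ] using this

end Lifting

/-! ### Irreducibility and separability of a minimal relation. -/

section MinimalRelation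

variable {K B : Type*} [Field K] [CommRing B] [Algebra K B] {s : ℕ}

theorem aeval_algebraMap_comp_eq_zero_iff {y : Fin s → B} {P : MvPolynomial (Fin s) K} :
    aeval (fun i => algebraMap B (FractionRing B) (y i)) P = 0 ↔ aeval y P = 0 := by
  have h : aeval (fun i => algebraMap B (FractionRing B) (y i)) P =
      algebraMap B (FractionRing B) (aeval y P) := aeval_algebraMap_apply (FractionRing B) y P
  rw [h, map_eq_zero_iff _ (IsFractionRing.injective B (FractionRing B))]

variable [IsDomain B]

/-- A relation of minimal degree is irreducible. -/
theorem irreducible_of_minimal {y : Fin s → B} {P : MvPolynomial (Fin s) K} (hP : P ≠ 0)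
    (hPy : aeval y P = 0)
    (hmin : ∀ P' : MvPolynomial (Fin s) K, P' ≠ 0 → aeval y P' = 0 →
      P.totalDegree ≤ P'.totalDegree) : Irreducible P :=
  irreducible_of_forall_totalDegree_le
    (a := fun i => algebraMap B (FractionRing B) (y i))
    (fun P' h0 h => hmin P' h0 (aeval_algebraMap_comp_eq_zero_iff.1 h)) hP
    (aeval_algebraMap_comp_eq_zero_iff.2 hPy)

/-- Over a perfect field, a relation of minimal degree has a nonzero partial derivative. -/
theorem exists_pderiv_ne_zero [PerfectField K] {y : Fin s → B} {P : MvPolynomial (Fin s) K}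
    (hP : P ≠ 0) (hPy : aeval y P = 0)
    (hmin : ∀ P' : MvPolynomial (Fin s) K, P' ≠ 0 → aeval y P' = 0 →
      P.totalDegree ≤ P'.totalDegree) : ∃ i, pderiv i P ≠ 0 := by
  suffices h : ∃ i, ∃ σ ∈ P.support, (σ i : K) ≠ 0 by
    obtain ⟨i, σ, hσ, hi⟩ := h
    have hi0 : σ i ≠ 0 := by rintro h; simp [h] at hi
    refine ⟨i, fun h => ?_⟩
    have h1 := congrArg (coeff (σ - Finsupp.single i 1)) h
    have h2 : σ - Finsupp.single i 1 + Finsupp.single i 1 = σ :=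
      tsub_add_cancel_of_le (by simpa using Nat.one_le_iff_ne_zero.2 hi0)
    have h3 : (((σ - Finsupp.single i 1 : Fin s →₀ ℕ) i : ℕ) : K) + 1 = σ i := by
      rw [Finsupp.tsub_apply, Finsupp.single_eq_same]
      exact_mod_cast congrArg (Nat.cast (R := K))
        (Nat.sub_add_cancel (Nat.one_le_iff_ne_zero.2 hi0))
    rw [coeff_pderiv, h2, h3, coeff_zero] at h1
    exact (mul_ne_zero (mem_support_iff.1 hσ) hi) h1
  obtain _ | ⟨p, hp, hpk⟩ := CharP.exists' K
  · by_contra! h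
    have hC : P = C (coeff 0 P) := by
      rw [← totalDegree_eq_zero_iff_eq_C, totalDegree_eq_zero_iff]
      intro σ hσ i
      exact_mod_cast h i σ hσ
    rw [hC, aeval_C, map_eq_zero_iff _ (FaithfulSMul.algebraMap_injective K B)] at hPy
    rw [hPy, C_0] at hC
    exact hP hC
  -- Over the perfect field `K`, taking `p`-th powers preserves linear independence. If `p` divided
  -- all exponents of `P`, the `p`-th roots of its monomials would thus satisfy a relation of
  -- smaller degree.
  · have : ExpChar K p := .prime hp.out
    have : CharP (FractionRing B) p :=
      .of_ringHom_of_ne_zero (algebraMap K (FractionRing B)) p hp.out.ne_zero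
    obtain ⟨i, σ, hσ, hi⟩ := exists_mem_support_not_dvd_of_forall_totalDegree_le
      (a := fun i => algebraMap B (FractionRing B) (y i)) p hp.out (fun s hs => by
        apply hs.map_of_injective_injective (frobeniusEquiv K p).symm
          (frobenius (FractionRing B) p).toAddMonoidHom
        · simp
        · simp [frobenius]
        · intro c x
          change ((frobeniusEquiv K p).symm c • x) ^ p = c • x ^ p
          rw [smul_pow, frobeniusEquiv_symm_pow_p])
      (fun P' h0 h => hmin P' h0 (aeval_algebraMap_comp_eq_zero_iff.1 h)) hP
      (aeval_algebraMap_comp_eq_zero_iff.2 hPy)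
    exact ⟨i, σ, hσ, fun h => hi ((CharP.cast_eq_zero_iff K p _).1 h)⟩

end MinimalRelation

/-! ### From section counts to relations of bounded degree. -/

section GenericSection

variable {K : Type*} [Field K] [IsAlgClosed K]

/-- Let the domain `B` of dimension `r` be integral over the `yᵢ`, and let there be no relation of
degree at most `d` between `y₀` and the `yᵢ`. Then, for general `v`, over a general point `b` of the
projection given by the `yᵢ - vᵢ y₀` there are more than `d` points. -/
theorem exists_shift_and_points {B : Type*} [CommRing B] [IsDomain B] [Algebra K B] {r d : ℕ}
    (hdim : ringKrullDim B = r) (y₀ : B) (y : Fin r → B)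
    (hy : (aeval y : MvPolynomial (Fin r) K →ₐ[K] B).toRingHom.IsIntegral)
    (hrel : ∀ P : MvPolynomial (Fin (r + 1)) K, P ≠ 0 →
      aeval (Fin.cons y₀ y : Fin (r + 1) → B) P = 0 → d < P.totalDegree)
    (H : MvPolynomial (Fin r) K) (hH : H ≠ 0) :
    ∃ v : Fin r → K, eval v H ≠ 0 ∧ ∃ g : MvPolynomial (Fin r) K, g ≠ 0 ∧
      ∀ b : Fin r → K, eval b g ≠ 0 → ∃ T : Finset K, d < T.card ∧
        ∀ t ∈ T, ∃ ψ : B →ₐ[K] K, (∀ i, ψ (y i - v i • y₀) = b i) ∧ ψ y₀ = t := by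
  classical
  have : Infinite K := IsAlgClosed.instInfinite
  let z : Fin (r + 1) → B := Fin.cons y₀ y
  have hdep : ∃ P : MvPolynomial (Fin (r + 1)) K, P ≠ 0 ∧ aeval z P = 0 := by
    by_contra! h
    have hz : AlgebraicIndependent K z := by
      rw [algebraicIndependent_iff]
      intro P hP
      by_contra h0
      exact h P h0 hP
    have hzint : (aeval z : MvPolynomial (Fin (r + 1)) K →ₐ[K] B).toRingHom.IsIntegral := by
      refine isIntegral_aeval_of_forall y z hy fun j => ?_
      have : y j = (aeval z : MvPolynomial (Fin (r + 1)) K →ₐ[K] B).toRingHom (X j.succ) := by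
        simp [z]
      rw [this]
      exact RingHom.isIntegralElem_map _
    have h1 := (ringKrullDim_le_of_isIntegral_of_injective _ hzint hz).trans hdim.le
    rw [MvPolynomial.ringKrullDim_of_isNoetherianRing, ringKrullDim_eq_zero_of_field, zero_add,
      Nat.card_eq_fintype_card, Fintype.card_fin] at h1
    have h2 : r + 1 ≤ r := by exact_mod_cast h1
    omega
  obtain ⟨P, ⟨hP, hPz⟩, hmin⟩ := (InvImage.wf (totalDegree (R := K) (σ := Fin (r + 1)))
    wellFounded_lt).has_min {P | P ≠ 0 ∧ aeval z P = 0} hdep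
  replace hmin : ∀ P' : MvPolynomial (Fin (r + 1)) K, P' ≠ 0 → aeval z P' = 0 →
      P.totalDegree ≤ P'.totalDegree := fun P' h0 h => not_lt.1 (hmin P' ⟨h0, h⟩)
  obtain ⟨l, hl⟩ := exists_pderiv_ne_zero hP hPz hmin
  obtain ⟨β, hβ⟩ := ne_zero_iff.1 hl
  -- As a linear form in the direction, this is the coefficient at `β` of the directional derivative
  -- of `P`; nonvanishing at `(1, v)` gives separability.
  let lin : MvPolynomial (Fin (r + 1)) K := ∑ i, C (coeff β (pderiv i P)) * X i
  have hlin_hom : lin.IsHomogeneous 1 :=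
    IsHomogeneous.sum _ _ _ fun i _ => isHomogeneous_C_mul_X _ _
  have hlin : lin ≠ 0 := by
    refine ne_zero_of_eval_ne_zero (x := Pi.single l 1) ?_
    simpa [lin, Pi.single_apply] using hβ
  obtain ⟨v, hv⟩ := exists_eval_ne_zero (mul_ne_zero (mul_ne_zero hH
    (aeval_cons_one_ne_zero hlin_hom hlin)) (aeval_cons_one_ne_zero
      (homogeneousComponent_isHomogeneous _ P) (homogeneousComponent_totalDegree_ne_zero hP)))
  have heval : ∀ Q : MvPolynomial (Fin (r + 1)) K, eval v
      (aeval (Fin.cons 1 X : Fin (r + 1) → MvPolynomial (Fin r) K) Q) =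
        eval (Fin.cons 1 v) Q := by
    intro Q
    rw [← coe_aeval_eq_eval, ← coe_aeval_eq_eval, RingHom.coe_coe, RingHom.coe_coe,
      ← AlgHom.comp_apply]
    congr 1
    ext i
    refine Fin.cases ?_ (fun j => ?_) i <;> simp
  rw [map_mul, map_mul, mul_ne_zero_iff, mul_ne_zero_iff, heval, heval] at hv
  obtain ⟨⟨hvH, hvlin⟩, hvtop⟩ := hv
  refine ⟨v, hvH, ?_⟩
  set c := eval (Fin.cons 1 v) (homogeneousComponent P.totalDegree P) with hc
  let y' : Fin r → B := fun i => y i - v i • y₀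
  have hy₀ : (aeval y' : MvPolynomial (Fin r) K →ₐ[K] B).toRingHom.IsIntegralElem y₀ :=
    isIntegralElem_of_shift v y₀ y P hPz hvtop
  have hy' : (aeval y' : MvPolynomial (Fin r) K →ₐ[K] B).toRingHom.IsIntegral := by
    refine isIntegral_aeval_of_forall y y' hy fun j => ?_
    have hj : y j = (aeval y' : MvPolynomial (Fin r) K →ₐ[K] B).toRingHom (X j) +
        (aeval y' : MvPolynomial (Fin r) K →ₐ[K] B).toRingHom (C (v j)) * y₀ := by
      simp [y', Algebra.smul_def]
    rw [hj]
    exact (RingHom.isIntegralElem_map _).add _ ((RingHom.isIntegralElem_map _).mul _ hy₀)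
  let p : Polynomial (MvPolynomial (Fin r) K) := Polynomial.C (C c⁻¹) * shiftEquiv v P
  have hunit : IsUnit (Polynomial.C (C c⁻¹) : Polynomial (MvPolynomial (Fin r) K)) :=
    ((isUnit_iff_ne_zero.2 (inv_ne_zero hvtop)).map C).map Polynomial.C
  have hpdeg : p.natDegree ≤ P.totalDegree :=
    (Polynomial.natDegree_C_mul_le _ _).trans (natDegree_shiftEquiv_le v P)
  have hpcoeff : p.coeff P.totalDegree = 1 := by
    rw [Polynomial.coeff_C_mul, coeff_shiftEquiv, ← hc, ← C_mul, inv_mul_cancel₀ hvtop, C_1]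
  have hmonic : p.Monic := Polynomial.monic_of_natDegree_le_of_coeff_eq_one _ hpdeg hpcoeff
  have hpnat : p.natDegree = P.totalDegree :=
    le_antisymm hpdeg (Polynomial.le_natDegree_of_ne_zero (by rw [hpcoeff]; exact one_ne_zero))
  have hirr : Irreducible p := by
    refine (irreducible_isUnit_mul hunit).2 ?_
    exact (MulEquiv.irreducible_iff (shiftEquiv v)).2 (irreducible_of_minimal hP hPz hmin)
  have hder : Polynomial.derivative p ≠ 0 := by
    rw [Polynomial.derivative_C_mul, derivative_shiftEquiv]
    refine mul_ne_zero hunit.ne_zero ((map_ne_zero_iff _ (shiftEquiv v).injective).2 fun h => ?_)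
    apply hvlin
    have h1 := congrArg (coeff β) h
    simp only [coeff_sum, coeff_C_mul, coeff_zero] at h1
    simpa [lin, mul_comm] using h1
  have hpy : p.eval₂ (aeval y' : MvPolynomial (Fin r) K →ₐ[K] B).toRingHom y₀ = 0 := by
    rw [Polynomial.eval₂_mul, eval₂_shiftEquiv]
    have : (Fin.cons y₀ fun i => y' i + v i • y₀ : Fin (r + 1) → B) = z := by
      simp [y', z]
    rw [this, hPz, mul_zero]
  obtain ⟨g, hg, hpts⟩ := exists_points_of_irreducible y' hy'
    (algebraicIndependent_of_isIntegral y' hy' hdim.ge) y₀ p hmonic hirr hder hpy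
  refine ⟨g, hg, fun b hb => ?_⟩
  obtain ⟨T, hT, hTψ⟩ := hpts b hb
  exact ⟨T, by rw [hT, hpnat]; exact hrel P hP hPz, hTψ⟩

/-- Let the linear sections of complementary dimension in general position of an irreducible
variety of dimension `r` have at most `d` points. Then any `r + 1` coordinates satisfy a
nonzero polynomial relation of degree at most `d` on the variety. -/
theorem exists_relation_of_isGenericSectionCard {n r d : ℕ} (Q : Ideal (MvPolynomial (Fin n) K))
    [Q.IsPrime] (hdim : ringKrullDim (MvPolynomial (Fin n) K ⧸ Q) = r) {δ : ℕ∞} (hδ : δ ≤ d)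
    (hG : IsGenericSectionCard (zeroLocus K Q) r δ) (ι : Fin (r + 1) → Fin n) :
    ∃ P : MvPolynomial (Fin (r + 1)) K, P ≠ 0 ∧ P.totalDegree ≤ d ∧ rename ι P ∈ Q := by
  classical
  have : Infinite K := IsAlgClosed.instInfinite
  by_contra! hno
  obtain ⟨G, hG0, hG⟩ := hG
  let B := MvPolynomial (Fin n) K ⧸ Q
  let W := zeroLocus K Q
  let x : Fin n → B := fun j => Ideal.Quotient.mk Q (X j)
  have hxmk : ∀ p : MvPolynomial (Fin n) K, aeval x p = Ideal.Quotient.mk Q p := by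
    intro p
    change _ = Ideal.Quotient.mkₐ K Q p
    congr 1
    ext j
    exact aeval_X x j
  have hvan : ∀ p : MvPolynomial (Fin n) K, (∀ w ∈ W, eval w p = 0) → p ∈ Q := by
    intro p hp
    rw [← IsPrime.vanishingIdeal_zeroLocus (K := K) Q]
    exact fun w hw => by simpa [coe_aeval_eq_eval] using hp w hw
  have hrn : r ≤ n := by
    have h1 := ringKrullDim_quotient_le Q
    rw [hdim, MvPolynomial.ringKrullDim_of_isNoetherianRing, ringKrullDim_eq_zero_of_field,
      zero_add, Nat.card_eq_fintype_card, Fintype.card_fin] at h1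
    exact_mod_cast h1
  have hL₀ : NoRelation W d (Matrix.of fun (i : Fin (r + 1)) (j : Fin n) =>
      if j = ι i then (1 : K) else 0) := by
    intro P hPd hP
    by_contra hP0
    refine hno P hP0 hPd (hvan _ fun w hw => ?_)
    rw [eval_rename, ← hP w hw]
    congr 2
    ext i
    simp [Matrix.mulVec, dotProduct]
  obtain ⟨N, hN0, hN⟩ := hL₀.exists_polynomial
  let ρ : (Fin r × Fin n) ⊕ Fin r → (Fin (r + 1) × Fin n) ⊕ Fin r :=
    Sum.map (Prod.map Fin.succ id) id
  have hρ : Function.Injective ρ :=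
    ((Fin.succ_injective r).prodMap Function.injective_id).sumMap Function.injective_id
  -- One point `q` fixes the form `c₀` and right-hand sides `b₀` so that the conditions `N` and `G`
  -- both remain nonzero in the other `r` rows.
  obtain ⟨q, hq⟩ := exists_eval_ne_zero (mul_ne_zero
    ((map_ne_zero_iff (rename (Sum.inl : _ → (Fin (r + 1) × Fin n) ⊕ Fin r))
      (rename_injective _ Sum.inl_injective)).2 hN0)
    ((map_ne_zero_iff (rename ρ) (rename_injective _ hρ)).2 hG0))
  rw [map_mul, mul_ne_zero_iff, eval_rename, eval_rename] at hq
  let c₀ : Fin n → K := fun j => q (Sum.inl (0, j))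
  let b₀ : Fin r → K := fun i => q (Sum.inr i)
  let N' : MvPolynomial (Fin r × Fin n) K := aeval (fun p : Fin (r + 1) × Fin n =>
    (Fin.cons (C (c₀ p.2)) (fun i => X (i, p.2)) :
      Fin (r + 1) → MvPolynomial (Fin r × Fin n) K) p.1) N
  have hN' : ∀ A : Matrix (Fin r) (Fin n) K, eval (fun p => A p.1 p.2) N' =
      eval (fun p => (Fin.cons c₀ A : Fin (r + 1) → Fin n → K) p.1 p.2) N := by
    intro A
    rw [← coe_aeval_eq_eval, ← coe_aeval_eq_eval, RingHom.coe_coe, RingHom.coe_coe,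
      ← AlgHom.comp_apply]
    congr 1
    ext ⟨i, j⟩
    refine Fin.cases ?_ (fun i => ?_) i <;> simp <;> rfl
  let G' : MvPolynomial (Fin r × Fin n) K := aeval (Sum.elim X fun i => C (b₀ i)) G
  have hG' : ∀ A : Matrix (Fin r) (Fin n) K, eval (fun p => A p.1 p.2) G' =
      eval (Sum.elim (fun p : Fin r × Fin n => A p.1 p.2) b₀) G := by
    intro A
    rw [← coe_aeval_eq_eval, ← coe_aeval_eq_eval, RingHom.coe_coe, RingHom.coe_coe,
      ← AlgHom.comp_apply]
    congr 1
    ext p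
    rcases p with p | i <;> simp
  have hH0 : N' * G' ≠ 0 := by
    refine ne_zero_of_eval_ne_zero (x := fun p => q (Sum.inl (p.1.succ, p.2))) ?_
    rw [map_mul]
    refine mul_ne_zero ?_ ?_
    · have := hN' fun i j => q (Sum.inl (i.succ, j))
      rw [this]
      convert hq.1 using 2
      congr 1
      ext ⟨i, j⟩
      refine Fin.cases ?_ (fun i => ?_) i <;> simp [c₀]
    · have := hG' fun i j => q (Sum.inl (i.succ, j))
      rw [this]
      convert hq.2 using 2
      congr 1
      ext p
      rcases p with p | i <;> rfl
  have hxint : (aeval x : MvPolynomial (Fin n) K →ₐ[K] B).toRingHom.IsIntegral := by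
    refine RingHom.isIntegral_of_surjective _ fun b => ?_
    obtain ⟨p, rfl⟩ := Ideal.Quotient.mk_surjective b
    exact ⟨p, hxmk p⟩
  obtain ⟨A, hA, hAint⟩ := exists_isIntegral_linear hdim.le hrn x hxint (N' * G') hH0
  rw [map_mul, mul_ne_zero_iff, hN', hG'] at hA
  have hNR := hN _ hA.1
  let y₀ : B := ∑ j, c₀ j • x j
  let y : Fin r → B := fun i => ∑ j, A i j • x j
  have hrel : ∀ P : MvPolynomial (Fin (r + 1)) K, P ≠ 0 →
      aeval (Fin.cons y₀ y : Fin (r + 1) → B) P = 0 → d < P.totalDegree := by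
    intro P hP0 hP
    by_contra! hPd
    refine hP0 (hNR P hPd fun w hw => ?_)
    let ψ : B →ₐ[K] K := Ideal.Quotient.liftₐ Q (aeval w) hw
    have h1 := congrArg ψ hP
    rw [map_zero, ← AlgHom.comp_apply] at h1
    rw [← h1, ← coe_aeval_eq_eval, RingHom.coe_coe]
    congr 1
    ext i
    have hψx : ∀ j, ψ (x j) = w j := fun j => aeval_X w j
    refine Fin.cases ?_ (fun i => ?_) i
    · simp [y₀, hψx, Matrix.mulVec, dotProduct]
      rfl
    · simp [y, hψx, Matrix.mulVec, dotProduct]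
      rfl
  -- `G` along the sheared systems with rows `A i - v i • c₀`; it is nonzero because `v = 0` gives
  -- back `A`.
  let Hs : MvPolynomial (Fin r) K := aeval (Sum.elim
    (fun p : Fin r × Fin n => C (A p.1 p.2) - X p.1 * C (c₀ p.2)) (fun i => C (b₀ i))) G
  have hHs : ∀ v : Fin r → K, eval v Hs =
      eval (Sum.elim (fun p : Fin r × Fin n => A p.1 p.2 - v p.1 * c₀ p.2) b₀) G := by
    intro v
    rw [← coe_aeval_eq_eval, ← coe_aeval_eq_eval, RingHom.coe_coe, RingHom.coe_coe,
      ← AlgHom.comp_apply]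
    congr 1
    ext p
    rcases p with p | i <;> simp
  have hHs0 : Hs ≠ 0 := by
    refine ne_zero_of_eval_ne_zero (x := 0) ?_
    rw [hHs]
    simpa using hA.2
  obtain ⟨v, hv, g, hg, hpts⟩ := exists_shift_and_points hdim y₀ y hAint hrel Hs hHs0
  rw [hHs] at hv
  let Av : Matrix (Fin r) (Fin n) K := fun i j => A i j - v i * c₀ j
  -- Now the rows are fixed and the right-hand side varies, so that `b` can also avoid the zeros of
  -- `g`.
  let Gb : MvPolynomial (Fin r) K := aeval (Sum.elim
    (fun p : Fin r × Fin n => C (Av p.1 p.2)) X) G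
  have hGb : ∀ b : Fin r → K, eval b Gb =
      eval (Sum.elim (fun p : Fin r × Fin n => Av p.1 p.2) b) G := by
    intro b
    rw [← coe_aeval_eq_eval, ← coe_aeval_eq_eval, RingHom.coe_coe, RingHom.coe_coe,
      ← AlgHom.comp_apply]
    congr 1
    ext p
    rcases p with p | i <;> simp
  have hGb0 : Gb ≠ 0 := ne_zero_of_eval_ne_zero (x := b₀) (by rw [hGb]; exact hv)
  obtain ⟨b, hb⟩ := exists_eval_ne_zero (mul_ne_zero hGb0 hg)
  rw [map_mul, mul_ne_zero_iff, hGb] at hb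
  have hcard := hG Av b hb.1
  obtain ⟨T, hT, hTψ⟩ := hpts b hb.2
  choose ψ hψy hψt using hTψ
  let pt : T → Fin n → K := fun t j => ψ t.1 t.2 (x j)
  have hpt : ∀ t p, aeval (pt t) p = ψ t.1 t.2 (Ideal.Quotient.mk Q p) := by
    intro t p
    rw [← hxmk, ← AlgHom.comp_apply]
    congr 1
    ext j
    simp [pt]
  have hmem : ∀ t, pt t ∈ W ∩ linearSection Av b := by
    intro t
    refine ⟨fun p hp => ?_, ?_⟩
    · rw [hpt, Ideal.Quotient.eq_zero_iff_mem.2 hp, map_zero]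
    · change Av.mulVec (pt t) = b
      ext i
      rw [← hψy t.1 t.2 i]
      simp [Matrix.mulVec, dotProduct, Av, pt, y, y₀, sub_mul, Finset.sum_sub_distrib,
        Finset.mul_sum, mul_assoc]
  -- The points are separated by the value of the form `c₀`, which at `pt t` is `t`.
  have hinj : Function.Injective pt := by
    intro t t' h
    apply Subtype.ext
    rw [← hψt t.1 t.2, ← hψt t'.1 t'.2]
    have hj : ∀ j, ψ t.1 t.2 (x j) = ψ t'.1 t'.2 (x j) := fun j => congrFun h j
    simp [y₀, hj]
  have hle : (T.card : ℕ∞) ≤ δ := by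
    have h1 := hinj.encard_range
    rw [ENat.card_eq_coe_fintype_card, Fintype.card_coe] at h1
    rw [← hcard]
    exact h1.trans <| Set.encard_le_encard (Set.range_subset_iff.2 hmem)
  have hle' : T.card ≤ d := by exact_mod_cast hle.trans hδ
  omega

end GenericSection

/-! ### Descent from the algebraic closure to the generators of `A`. -/

section Main

variable {F K : Type*} [Field F] [Field K] [Algebra F K]

theorem zeroLocus_map {n : ℕ} (I : Ideal (MvPolynomial (Fin n) F)) :
    zeroLocus K (I.map (MvPolynomial.map (algebraMap F K))) = zeroLocus K I := by
  rw [Ideal.map, zeroLocus_span]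
  ext x
  simp [aeval_def]

/-- Carries one monic equation between a fraction field over `K` and `A` through a polynomial over
`F`. -/
theorem aeval_eval₂ {R : Type*} [CommRing R] [Algebra F R] {n m : ℕ} (y : Fin n → R)
    (f : Fin m → MvPolynomial (Fin n) F) (g : Polynomial (MvPolynomial (Fin m) F))
    (q : MvPolynomial (Fin n) F) :
    aeval y (g.eval₂ (aeval f : MvPolynomial (Fin m) F →ₐ[F] _).toRingHom q) =
      g.eval₂ (aeval (fun i => aeval y (f i)) : MvPolynomial (Fin m) F →ₐ[F] R).toRingHom
        (aeval y q) := by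
  change (aeval y : MvPolynomial (Fin n) F →ₐ[F] R).toRingHom _ = _
  rw [Polynomial.hom_eval₂]
  congr 1
  ext i <;> simp

attribute [local instance] MvPolynomial.algebraMvPolynomial

/-- If `Q` contains the extension of `I` to an algebraic extension of the base field, then
`V(Q)` has at most the dimension of `V(I)`. -/
theorem ringKrullDim_quotient_le_of_map_le [Algebra.IsAlgebraic F K] {n : ℕ}
    {I : Ideal (MvPolynomial (Fin n) F)} {Q : Ideal (MvPolynomial (Fin n) K)}
    (hIQ : I.map (MvPolynomial.map (algebraMap F K)) ≤ Q) :
    ringKrullDim (MvPolynomial (Fin n) K ⧸ Q) ≤ ringKrullDim (MvPolynomial (Fin n) F ⧸ I) := by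
  let η : MvPolynomial (Fin n) F ⧸ I →+* MvPolynomial (Fin n) K ⧸ Q :=
    Ideal.quotientMap Q (MvPolynomial.map (algebraMap F K)) (Ideal.map_le_iff_le_comap.1 hIQ)
  apply ringKrullDim_le_of_isIntegral η
  apply RingHom.IsIntegral.tower_top (Ideal.Quotient.mk I) η
  have h1 : η.comp (Ideal.Quotient.mk I) =
      (Ideal.Quotient.mk Q).comp (MvPolynomial.map (algebraMap F K)) := by
    ext x <;> rfl
  rw [h1]
  refine RingHom.IsIntegral.trans _ _ ?_
    (RingHom.isIntegral_of_surjective _ Ideal.Quotient.mk_surjective)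
  exact (inferInstance :
    Algebra.IsIntegral (MvPolynomial (Fin n) F) (MvPolynomial (Fin n) K)).isIntegral

/-- The generators of an affine algebra of dimension at most `k` and degree at most `d` are integral
over the elements `∑ⱼ Mᵢⱼ aⱼ ^ eⱼ`. -/
theorem isIntegralElem_generator {A : Type*} [CommRing A] [Algebra F A] {n m k d : ℕ}
    (hkn : k ≤ n) (e : Fin n → ℕ) (he : ∀ j, d < e j)
    (hcop : Pairwise fun i j => Nat.Coprime (e i) (e j))
    (M : Matrix (Fin m) (Fin n) F) (hM : IsRegularMatrix k M) (a : Fin n → A)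
    (hsurj : Function.Surjective (aeval a : MvPolynomial (Fin n) F →ₐ[F] A))
    (hdim : ringKrullDim A ≤ k)
    (hdeg : degreeOfIdeal (RingHom.ker (aeval a : MvPolynomial (Fin n) F →ₐ[F] A)) ≤ d)
    (j : Fin n) :
    (aeval (fun i => aeval a (dklPoly M e i)) :
      MvPolynomial (Fin m) F →ₐ[F] A).toRingHom.IsIntegralElem (a j) := by
  let K := AlgebraicClosure F
  let I := RingHom.ker (aeval a : MvPolynomial (Fin n) F →ₐ[F] A)
  let res : MvPolynomial (Fin n) F →+* MvPolynomial (Fin n) K := MvPolynomial.map (algebraMap F K)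
  refine isIntegralElem_of_forall_isPrime _ _ fun p hp => ?_
  let P₀ : Ideal (MvPolynomial (Fin n) F) :=
    p.comap (aeval a : MvPolynomial (Fin n) F →ₐ[F] A)
  have hIP₀ : I ≤ P₀ := fun f hf => by
    change aeval a f ∈ p
    rw [show aeval a f = 0 from hf]
    exact p.zero_mem
  have hP₀ : P₀.IsPrime := Ideal.comap_isPrime _ p
  obtain ⟨Q', -, hQ', hQ'P₀⟩ := Ideal.exists_ideal_over_prime_of_isIntegral
    (S := MvPolynomial (Fin n) K) P₀ ⊥ (by
      rw [← RingHom.ker_eq_comap_bot]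
      exact ((RingHom.injective_iff_ker_eq_bot res).1
        (map_injective (algebraMap F K) (algebraMap F K).injective)).le.trans bot_le)
  have hQ'P₀ : Q'.comap res = P₀ := hQ'P₀
  have hIQ' : I.map res ≤ Q' := Ideal.map_le_iff_le_comap.2 (by rw [hQ'P₀]; exact hIP₀)
  -- The degree bound concerns components, so relations are found on `V(Q)`; they persist on the
  -- subvariety `V(Q')`.
  obtain ⟨Q, hQ, hQQ'⟩ := Ideal.exists_minimalPrimes_le hIQ'
  have hQprime : Q.IsPrime := hQ.1.1
  obtain ⟨r, δ, hr, hδ, hcard⟩ := exists_isGenericSectionCard (K := K) (d := d) hQ (by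
    rw [zeroLocus_map]; exact hdeg)
  have hrk : r ≤ k := by
    have h1 := ringKrullDim_quotient_le_of_map_le hQ.1.2
    have h2 : ringKrullDim (MvPolynomial (Fin n) F ⧸ I) = ringKrullDim A :=
      ringKrullDim_eq_of_ringEquiv (Ideal.quotientKerAlgEquivOfSurjective hsurj).toRingEquiv
    rw [hr, h2] at h1
    exact_mod_cast h1.trans hdim
  let B := MvPolynomial (Fin n) K ⧸ Q'
  let E := FractionRing B
  let x : Fin n → E := fun j => algebraMap B E (Ideal.Quotient.mk Q' (X j))
  have hxK : ∀ f : MvPolynomial (Fin n) K, aeval x f = algebraMap B E (Ideal.Quotient.mk Q' f) := by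
    intro f
    change _ = ((IsScalarTower.toAlgHom K B E).comp (Ideal.Quotient.mkₐ K Q')) f
    congr 1
    ext j
    exact aeval_X x j
  have hx0 : ∀ f : MvPolynomial (Fin n) K, aeval x f = 0 ↔ f ∈ Q' := by
    intro f
    rw [hxK, map_eq_zero_iff _ (IsFractionRing.injective B E), Ideal.Quotient.eq_zero_iff_mem]
  obtain ⟨g, hg, hgx⟩ := isIntegralElem_of_relations (F := F) (K := K) (d := d) hkn e he hcop M hM x
    (fun ι hι => by
      have hle : r + 1 ≤ k + 1 := by omega
      obtain ⟨P, hP, hPd, hPQ⟩ := exists_relation_of_isGenericSectionCard Q hr hδ hcard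
        (ι ∘ Fin.castLE hle)
      refine ⟨rename (Fin.castLE hle) P, (map_ne_zero_iff _
        (rename_injective _ (Fin.castLE_injective hle))).2 hP,
        (totalDegree_rename_le _ _).trans hPd, ?_⟩
      have := (hx0 _).2 (hQQ' hPQ)
      rw [aeval_rename] at this ⊢
      exact this) j
  refine ⟨g, hg, ?_⟩
  -- `h` is the integral equation written over `F`; its vanishing modulo `Q'` puts it in `P₀`, so
  -- its value at `a` lies in `p`.
  let h : MvPolynomial (Fin n) F :=
    g.eval₂ (aeval (dklPoly M e) : MvPolynomial (Fin m) F →ₐ[F] _).toRingHom (X j)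
  have hxh : aeval x (res h) = 0 := by
    rw [aeval_map_algebraMap, aeval_eval₂, aeval_X, hgx]
  have hP₀h : h ∈ P₀ := by
    rw [← hQ'P₀]
    exact (hx0 _).1 hxh
  have hah : aeval a h ∈ p := hP₀h
  rwa [aeval_eval₂, aeval_X] at hah

end Main

end NoetherNorm

end

/-! ### The theorem: finiteness from integrality and finite type, then independence. -/

open MvPolynomial NoetherNorm in
theorem mainTheorem5 {F : Type*} [Field F] {A : Type*} [CommRing A] [Algebra F A]
    (n m k d : ℕ) (hm : 1 ≤ m) (hmn : m ≤ n) (hk : 1 ≤ k) (hkn : k ≤ n) (hd : 1 ≤ d)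
    (e : Fin n → ℕ) (he : ∀ j, d < e j)
    (hcop : Pairwise fun i j => Nat.Coprime (e i) (e j))
    (M : Matrix (Fin m) (Fin n) F) (hM : NoetherNorm.IsRegularMatrix k M)
    (a : Fin n → A) (hgen : Algebra.adjoin F (Set.range a) = ⊤)
    (hdim : ringKrullDim A ≤ k)
    (hdeg : NoetherNorm.degreeOfIdeal
      (RingHom.ker (MvPolynomial.aeval a : MvPolynomial (Fin n) F →ₐ[F] A)) ≤ d) :
    Module.Finite
      (Algebra.adjoin F (Set.range fun i => MvPolynomial.aeval a (NoetherNorm.dklPoly M e i))) A ∧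
    (ringKrullDim A = k → k = m →
      AlgebraicIndependent F (fun i => MvPolynomial.aeval a (NoetherNorm.dklPoly M e i)) ∧
      ∃ Φ : Algebra.adjoin F
            (Set.range fun i => MvPolynomial.aeval a (NoetherNorm.dklPoly M e i)) ≃ₐ[F]
          MvPolynomial (Fin m) F,
        ∀ i, Φ ⟨MvPolynomial.aeval a (NoetherNorm.dklPoly M e i),
          Algebra.subset_adjoin (Set.mem_range_self i)⟩ = MvPolynomial.X i) := by
  have hsurj : Function.Surjective (aeval a : MvPolynomial (Fin n) F →ₐ[F] A) := by
    rw [← AlgHom.range_eq_top, ← Algebra.adjoin_range_eq_range_aeval, hgen]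
  let f : Fin m → A := fun i => aeval a (dklPoly M e i)
  have hint : (aeval f : MvPolynomial (Fin m) F →ₐ[F] A).toRingHom.IsIntegral :=
    isIntegral_aeval_of_forall a f (RingHom.isIntegral_of_surjective _ hsurj)
      (isIntegralElem_generator hkn e he hcop M hM a hsurj hdim hdeg)
  let S := Algebra.adjoin F (Set.range f)
  have hfS : ∀ p : MvPolynomial (Fin m) F, aeval f p ∈ S := fun p => by
    change _ ∈ Algebra.adjoin F (Set.range f)
    rw [Algebra.adjoin_range_eq_range_aeval]
    exact ⟨p, rfl⟩
  have hS : Algebra.IsIntegral S A := by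
    refine ⟨fun x => ?_⟩
    obtain ⟨g, hg, hgx⟩ := hint x
    refine ⟨g.map ((aeval f : MvPolynomial (Fin m) F →ₐ[F] A).codRestrict S hfS).toRingHom,
      hg.map _, ?_⟩
    rw [Polynomial.eval₂_map]
    exact hgx
  have hft : Algebra.FiniteType F A :=
    ⟨⟨(Set.finite_range a).toFinset, by rw [Set.Finite.coe_toFinset, hgen]⟩⟩
  have hftS : Algebra.FiniteType S A := Algebra.FiniteType.of_restrictScalars_finiteType F S A
  refine ⟨Algebra.IsIntegral.finite, fun hdimk hkm => ?_⟩
  subst hkm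
  have hind : AlgebraicIndependent F f := algebraicIndependent_of_isIntegral f hint hdimk.ge
  refine ⟨hind, hind.aevalEquiv.symm, fun i => ?_⟩
  rw [AlgEquiv.symm_apply_eq]
  ext
  simp [f]
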